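/- **Theorem 3.15 (Laplace's Inequalities).** Let $V\subset\mathbb R^n$ be a homogeneous cone: $V$ is non-empty and open; $\lambda x\in V$ and $x+y\in V$ whenever $x,y\in V$, $\lambda>0$; if $0\ne x\in\overline V$ then $-x\notin\overline V$; and for all $x,y\in V$ there is an invertible linear map $A$ of $\mathbb R^n$ with $A(V)=V$ and $Ax=y$. Let $$V^*=\{x\in\mathbb R^n: x\cdot y>0\ \text{ for all } y\in\overline V,\ y\neq0\}$$ be the dual cone, let $$\phi_V(x)=\int_{V^*}e^{-x\cdot y}\,dy,\qquad x^*=-\operatorname{grad}\log\phi_V(x)\qquad(x\in V),$$ let $\Delta_V(x)$ be the Lebesgue measure of $\{y\in V: x-y\in V\}$ for $x\in V$, and put $$\sigma(V)=\max\{-1,\sigma_0(V)\},\qquad \sigma_0(V)=\inf\Big\{\alpha\in\mathbb R:\int_{\Sigma_V}\Delta_V^{\alpha}(t)\,dt<\infty\Big\}\in[-\infty,\infty),$$ where $\Sigma_V=\{t\in V:|t|=1\}$ carries the surface measure; $\Delta_{V^*}$ and $\sigma(V^*)$ are defined in the same way from $V^*$. For measurable $f:V\to[0,\infty]$ let $$Lf(x)=\int_V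 e^{-x^*\cdot y}f(y)\,dy\qquad(x\in V).$$ For $1\le p<\infty$ write $1/p'=1-1/p$ (so $1/p'=0$ if $p=1$). 1. If $1\le p\le q<\infty$ and $\gamma<-\sigma(V)\,q/p'-\sigma(V^*)+q/p-2$, then there is a finite constant $c$, independent of $f$, such that for all measurable $f\ge0$ on $V$ $$\left(\int_V\Delta_V^{\gamma-q}(x)\,(Lf(x))^q\,dx\right)^{1/q}\le c\left(\int_V f^p(x)\,\Delta_V^{(\gamma+1)p/q-1}(x)\,dx\right)^{1/p}.$$ 2. If $1\le p<\infty$ and $\alpha<1/p-\sigma(V)/p'$, then there is a finite constant $c$, independent of $f$, such that for all measurable $f\ge0$ on $V$ $$\operatorname*{ess\,sup}_{x\in V}\Big(\Delta_V^{-1+\alpha}(x)\,L(f\Delta_V^{-\alpha})(x)\Big)\le c\left(\int_V f^p(x)\,\Delta_V^{-1}(x)\,dx\right)^{1/p}.$$ 3. If $\alpha<-\sigma(V)$, then there is a finite constant $c$, independent of $f$, such that for all measurable $f\ge0$ on $V$ $$\operatorname*{ess\,sup}_{x\in V}\Big(\Delta_V^{-1+\alpha}(x)\,L(f\Delta_V^{-\alpha})(x)\Big)\le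 c\,\operatorname*{ess\,sup}_{x\in V}f(x).$$ -/

import Mathlib

open MeasureTheory
open scoped ENNReal NNReal

noncomputable section

/-- Open convex cones in `ℝⁿ` whose closure contains no line. -/
structure IsOpenProperCone {n : ℕ} (V : Set (EuclideanSpace ℝ (Fin n))) : Prop where
  nonempty : V.Nonempty
  isOpen : IsOpen V
  smul_mem : ∀ x ∈ V, ∀ r : ℝ, 0 < r → r • x ∈ V
  add_mem : ∀ x ∈ V, ∀ y ∈ V, x + y ∈ V
  neg_notMem : ∀ x ∈ closure V, x ≠ 0 → -x ∉ closure V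

/-- A cone on which the group of invertible linear maps of `ℝⁿ` mapping `V` onto `V` acts
transitively. -/
structure IsHomogeneousCone {n : ℕ} (V : Set (EuclideanSpace ℝ (Fin n))) : Prop
    extends IsOpenProperCone V where
  transitive : ∀ x ∈ V, ∀ y ∈ V,
    ∃ A : EuclideanSpace ℝ (Fin n) ≃ₗ[ℝ] EuclideanSpace ℝ (Fin n), A '' V = V ∧ A x = y

/-- The (open) dual cone `V*`. -/
def openDualCone {n : ℕ} (V : Set (EuclideanSpace ℝ (Fin n))) :
    Set (EuclideanSpace ℝ (Fin n)) :=
  {x | ∀ y ∈ closure V, y ≠ 0 → 0 < inner ℝ x y}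

/-- The cone interval `⟨a, b⟩ = {x ∈ V : a <_V x <_V b}`, where `x <_V y` means `y - x ∈ V`. -/
def coneInterval {n : ℕ} (V : Set (EuclideanSpace ℝ (Fin n)))
    (a b : EuclideanSpace ℝ (Fin n)) : Set (EuclideanSpace ℝ (Fin n)) :=
  {x | x ∈ V ∧ x - a ∈ V ∧ b - x ∈ V}

/-- `Δ_V(x)`: the Lebesgue measure of the cone interval `⟨0, x⟩`
(finite and positive for `x ∈ V`). -/
def coneDelta {n : ℕ} (V : Set (EuclideanSpace ℝ (Fin n)))
    (x : EuclideanSpace ℝ (Fin n)) : ℝ :=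
  (volume (coneInterval V 0 x)).toReal

/-- The characteristic function `φ_V(x) = ∫_{V*} e^{-x·y} dy` (convergent for `x ∈ V`). -/
def coneCharFun {n : ℕ} (V : Set (EuclideanSpace ℝ (Fin n)))
    (x : EuclideanSpace ℝ (Fin n)) : ℝ :=
  ∫ y in openDualCone V, Real.exp (-(inner ℝ x y))

/-- The map `x ↦ x* = -grad log φ_V(x)`. -/
def coneStar {n : ℕ} (V : Set (EuclideanSpace ℝ (Fin n)))
    (x : EuclideanSpace ℝ (Fin n)) : EuclideanSpace ℝ (Fin n) :=
  -gradient (fun z => Real.log (coneCharFun V z)) x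

/-- `∫_{Σ_V} Δ_V^α(t) dt`, where `Σ_V = V ∩ S^{n-1}` carries the surface measure. -/
def coneSphereIntegral {n : ℕ} (V : Set (EuclideanSpace ℝ (Fin n))) (α : ℝ) : ℝ≥0∞ :=
  ∫⁻ t in {t : Metric.sphere (0 : EuclideanSpace ℝ (Fin n)) 1 |
      (t : EuclideanSpace ℝ (Fin n)) ∈ V},
    ENNReal.ofReal (coneDelta V t ^ α)
    ∂((volume : Measure (EuclideanSpace ℝ (Fin n))).toSphere)

/-- `σ₀(V) = inf {α ∈ ℝ : ∫_{Σ_V} Δ_V^α < ∞}`. The infimum is taken in the extended reals: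
it is `-∞` for the half line. -/
def coneSigmaZero {n : ℕ} (V : Set (EuclideanSpace ℝ (Fin n))) : EReal :=
  sInf ((fun α : ℝ => (α : EReal)) '' {α : ℝ | coneSphereIntegral V α < ∞})

/-- `σ(V) = max {-1, σ₀(V)}`. It is a real number, since `σ₀(V) ≤ 0`: the exponent `α = 0` gives
the finite surface measure of `Σ_V`. -/
def coneSigma {n : ℕ} (V : Set (EuclideanSpace ℝ (Fin n))) : ℝ :=
  (max (-1) (coneSigmaZero V)).toReal

/-- The weight `Δ_V^s(x)` with values in `[0, ∞]`. -/
def coneWeight {n : ℕ} (V : Set (EuclideanSpace ℝ (Fin n))) (s : ℝ)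
    (x : EuclideanSpace ℝ (Fin n)) : ℝ≥0∞ :=
  ENNReal.ofReal (coneDelta V x ^ s)

/-- Laplace's operator `Lf(x) = ∫_V e^{-x*·y} f(y) dy` on nonnegative functions. -/
def coneLaplace {n : ℕ} (V : Set (EuclideanSpace ℝ (Fin n)))
    (f : EuclideanSpace ℝ (Fin n) → ℝ≥0∞) (x : EuclideanSpace ℝ (Fin n)) : ℝ≥0∞ :=
  ∫⁻ y in V, ENNReal.ofReal (Real.exp (-(inner ℝ (coneStar V x) y))) * f y

end

/-! Everything is read off from the symmetry group. With respect to the measure `dμ = Δ_V⁻¹ dx`,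
which is invariant under the automorphisms of `V`, the operator `L` weighted by powers of `Δ_V` has
the kernel `k_{c,b}(x,y) = e^{-c x*·y} (Δ_V(y)/Δ_V(x))^b` with `c = 1`. This kernel satisfies
`k(Ax,Ay) = k(x,y)`, because `(Ax)*·(Ay) = x*·y` and `Δ_V(Ax) = |det A| Δ_V(x)`. By transitivity, a
bound at one base point is a uniform bound.

Three bounds are needed. The integral of `k_{c,b}` in `y` is finite for `b > σ(V) + 1`, by polar
coordinates. The kernel is bounded for `b > 0`. The integral in `x` is finite for `b > σ(V*) + 1`,
by passing to `V*`. No change of variables `x ↦ x*` is made there: `x*` is thickened to an order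
interval of `V*`, on which `Δ_{V*}` is comparable to `Δ_V(x)⁻¹`, and Fubini moves the integral to
`V*`.

For the `L^p → L^q` bound, split `k_{1,t} = k_{1/2,a} k_{1/2,t-a}`. Hölder puts the first factor in
`L^{p'}(dμ(y))`; Jensen for `g^p dμ` with exponent `q/p`, followed by Fubini, leaves the integral in
`x` of the second factor to the power `q`. A suitable `a` exists exactly when `(σ(V)+1)/p' +
(σ(V*)+1)/q < t`, which is the hypothesis on `γ` for `t = 1 - (γ+1)/q`. The two supremum bounds
follow from Hölder and from the integral in `y`. -/

/-! ### Proper cones and their duals -/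

lemma inner_nonneg_of_mem_closure_openDualCone {n : ℕ} {W : Set (EuclideanSpace ℝ (Fin n))}
    {x u : EuclideanSpace ℝ (Fin n)}
    (hu : u ∈ closure (openDualCone W)) (hx : x ∈ closure W) : 0 ≤ inner ℝ u x := by
  rcases eq_or_ne x 0 with rfl | h0
  · simp
  have h : closure (openDualCone W) ⊆ {u | 0 ≤ inner ℝ u x} :=
    closure_minimal (fun v hv => (hv x hx h0).le)
      (isClosed_le continuous_const (by fun_prop))
  exact h hu

namespace IsOpenProperCone

variable {n : ℕ} {W : Set (EuclideanSpace ℝ (Fin n))}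

lemma convex (hW : IsOpenProperCone W) : Convex ℝ W := by
  intro x hx y hy a b ha hb hab
  rcases ha.eq_or_lt with rfl | ha
  · obtain rfl : b = 1 := by linarith
    simpa using hy
  rcases hb.eq_or_lt with rfl | hb
  · obtain rfl : a = 1 := by linarith
    simpa using hx
  exact hW.add_mem _ (hW.smul_mem x hx a ha) _ (hW.smul_mem y hy b hb)

lemma smul_mem_closure (hW : IsOpenProperCone W) {x : EuclideanSpace ℝ (Fin n)}
    (hx : x ∈ closure W) {r : ℝ} (hr : 0 < r) : r • x ∈ closure W :=
  map_mem_closure (continuous_const_smul r) hx fun y hy => hW.smul_mem y hy r hr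

lemma zero_mem_closure (hW : IsOpenProperCone W) : (0 : EuclideanSpace ℝ (Fin n)) ∈ closure W := by
  obtain ⟨x, hx⟩ := hW.nonempty
  have h : Filter.Tendsto (fun r : ℝ => r • x) (nhdsWithin 0 (Set.Ioi 0)) (nhds ((0 : ℝ) • x)) :=
    ((continuous_id.smul continuous_const).tendsto 0).mono_left nhdsWithin_le_nhds
  rw [zero_smul] at h
  exact mem_closure_of_tendsto h
    (by filter_upwards [self_mem_nhdsWithin] with r hr using hW.smul_mem x hx r hr)

/-- A point of the dual cone is coercive on the closure of the cone. -/
lemma exists_le_inner (hW : IsOpenProperCone W) {u : EuclideanSpace ℝ (Fin n)}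
    (hu : u ∈ openDualCone W) : ∃ c > 0, ∀ y ∈ closure W, c * ‖y‖ ≤ inner ℝ u y := by
  have hK : IsCompact (closure W ∩ Metric.sphere 0 1) :=
    (isCompact_sphere 0 1).inter_left isClosed_closure
  have hne {y : EuclideanSpace ℝ (Fin n)} (hy : y ∈ Metric.sphere 0 1) : y ≠ 0 := by
    rintro rfl; simp at hy
  obtain ⟨c, hc, hcK⟩ : ∃ c > 0, ∀ y ∈ closure W ∩ Metric.sphere 0 1, c ≤ inner ℝ u y := by
    rcases (closure W ∩ Metric.sphere 0 1).eq_empty_or_nonempty with h | h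
    · exact ⟨1, one_pos, by simp [h]⟩
    · obtain ⟨y, hy, hmin⟩ := hK.exists_isMinOn h
        (f := fun y => inner ℝ u y) (by fun_prop)
      exact ⟨_, hu y hy.1 (hne hy.2), fun z hz => hmin hz⟩
  refine ⟨c, hc, fun y hy => ?_⟩
  rcases eq_or_ne y 0 with rfl | h0
  · simp
  have hpos : 0 < ‖y‖ := norm_pos_iff.2 h0
  have := hcK (‖y‖⁻¹ • y) ⟨hW.smul_mem_closure hy (inv_pos.2 hpos), by simp [norm_smul, hpos.ne']⟩
  rw [inner_smul_right, inv_mul_eq_div, le_div_iff₀ hpos] at this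
  exact this

/-- Since `W` is open, `x` can be moved a fixed distance against `u` without leaving `W`, and the
moved point still pairs nonnegatively with `u`. -/
lemma exists_le_inner_of_mem (hW : IsOpenProperCone W) {x : EuclideanSpace ℝ (Fin n)}
    (hx : x ∈ W) : ∃ c > 0, ∀ u ∈ closure (openDualCone W), c * ‖u‖ ≤ inner ℝ x u := by
  obtain ⟨ε, hε, hb⟩ := Metric.isOpen_iff.1 hW.isOpen x hx
  refine ⟨ε / 2, by positivity, fun u hu => ?_⟩
  rcases eq_or_ne u 0 with rfl | h0
  · simp
  have hpos : 0 < ‖u‖ := norm_pos_iff.2 h0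
  have hm : x - (ε / 2 * ‖u‖⁻¹) • u ∈ W := by
    apply hb
    rw [mem_ball_iff_norm, sub_sub_cancel_left, norm_neg, norm_smul, Real.norm_of_nonneg
      (by positivity), mul_assoc, inv_mul_cancel₀ hpos.ne']
    linarith
  have := inner_nonneg_of_mem_closure_openDualCone hu (subset_closure hm)
  rw [inner_sub_right, inner_smul_right, real_inner_self_eq_norm_sq, real_inner_comm] at this
  have e : ε / 2 * ‖u‖⁻¹ * ‖u‖ ^ 2 = ε / 2 * ‖u‖ := by field_simp
  linarith

lemma isOpen_openDualCone (hW : IsOpenProperCone W) : IsOpen (openDualCone W) := by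
  rw [Metric.isOpen_iff]
  intro u hu
  obtain ⟨c, hc, h⟩ := hW.exists_le_inner hu
  refine ⟨c, hc, fun v hv y hy h0 => ?_⟩
  have hpos : 0 < ‖y‖ := norm_pos_iff.2 h0
  have h1 := h y hy
  have h2 : |inner ℝ (v - u) y| ≤ ‖v - u‖ * ‖y‖ := abs_real_inner_le_norm _ _
  rw [inner_sub_left] at h2
  have h3 : ‖v - u‖ * ‖y‖ < c * ‖y‖ := by
    gcongr; exact mem_ball_iff_norm.1 hv
  linarith [(abs_le.1 h2).1]

/-- Properness keeps `-y` out of the closed convex cone, so Hahn–Banach separates the two. -/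
lemma exists_nonneg_functional (hW : IsOpenProperCone W) {y : EuclideanSpace ℝ (Fin n)}
    (hy : y ∈ closure W) (h0 : y ≠ 0) :
    ∃ f : StrongDual ℝ (EuclideanSpace ℝ (Fin n)), 0 < f y ∧ ∀ z ∈ closure W, 0 ≤ f z := by
  obtain ⟨f, r, hfy, hf⟩ := geometric_hahn_banach_point_closed hW.convex.closure isClosed_closure
    (hW.neg_notMem y hy h0)
  have hr : r < 0 := by simpa using hf 0 hW.zero_mem_closure
  refine ⟨f, by rw [map_neg] at hfy; linarith, fun z hz => ?_⟩
  by_contra! hneg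
  -- A negative value at `z` could be scaled to equal the separating level `r`, which the closed
  -- cone stays strictly above.
  have := hf _ (hW.smul_mem_closure hz (div_pos_of_neg_of_neg hr hneg))
  rw [map_smul, smul_eq_mul, div_mul_cancel₀ _ hneg.ne] at this
  exact this.false

/-- Each unit vector of the closed cone has a functional that is nonnegative on the cone and
positive near that vector. By compactness a finite sum of these is positive in all directions. -/
lemma openDualCone_nonempty (hW : IsOpenProperCone W) : (openDualCone W).Nonempty := by
  have hK : IsCompact (closure W ∩ Metric.sphere 0 1) :=
    (isCompact_sphere 0 1).inter_left isClosed_closure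
  obtain ⟨f, hf, -⟩ : ∃ f : StrongDual ℝ (EuclideanSpace ℝ (Fin n)),
      (∀ y ∈ closure W ∩ Metric.sphere 0 1, 0 < f y) ∧ ∀ z ∈ closure W, 0 ≤ f z := by
    refine hK.induction_on (p := fun s => ∃ f : StrongDual ℝ (EuclideanSpace ℝ (Fin n)),
      (∀ y ∈ closure W ∩ s, 0 < f y) ∧ ∀ z ∈ closure W, 0 ≤ f z) ⟨0, by simp, by simp⟩ ?_ ?_ ?_
      |>.imp fun f hf => ⟨fun y hy => hf.1 y ⟨hy.1, hy⟩, hf.2⟩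
    · rintro s t hst ⟨f, hf, hf'⟩
      exact ⟨f, fun y hy => hf y ⟨hy.1, hst hy.2⟩, hf'⟩
    · rintro s t ⟨f, hf, hf'⟩ ⟨g, hg, hg'⟩
      refine ⟨f + g, fun y hy => ?_, fun z hz => add_nonneg (hf' z hz) (hg' z hz)⟩
      rcases hy.2 with h | h
      · exact add_pos_of_pos_of_nonneg (hf y ⟨hy.1, h⟩) (hg' y hy.1)
      · exact add_pos_of_nonneg_of_pos (hf' y hy.1) (hg y ⟨hy.1, h⟩)
    · rintro y ⟨hy, hy1⟩
      obtain ⟨f, hfy, hf⟩ := hW.exists_nonneg_functional hy (by rintro rfl; simp at hy1)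
      exact ⟨{z | 0 < f z}, mem_nhdsWithin_of_mem_nhds
        ((isOpen_lt continuous_const f.continuous).mem_nhds hfy), f, fun z hz => hz.2, hf⟩
  refine ⟨(InnerProductSpace.toDual ℝ _).symm f, fun y hy h0 => ?_⟩
  rw [InnerProductSpace.toDual_symm_apply]
  have hpos : 0 < ‖y‖ := norm_pos_iff.2 h0
  have := hf (‖y‖⁻¹ • y)
    ⟨hW.smul_mem_closure hy (inv_pos.2 hpos), by simp [norm_smul, hpos.ne']⟩
  rw [map_smul, smul_eq_mul] at this
  exact (pos_iff_pos_of_mul_pos this).1 (inv_pos.2 hpos)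

/-- This lets every estimate for `Δ` and `σ` be applied to the dual cone as well. -/
lemma dual (hW : IsOpenProperCone W) : IsOpenProperCone (openDualCone W) where
  nonempty := hW.openDualCone_nonempty
  isOpen := hW.isOpen_openDualCone
  smul_mem u hu r hr y hy h0 := by
    rw [inner_smul_left]
    exact mul_pos hr (hu y hy h0)
  add_mem u hu v hv y hy h0 := by
    rw [inner_add_left]
    exact add_pos (hu y hy h0) (hv y hy h0)
  neg_notMem u hu h0 hneg := by
    obtain ⟨x, hx⟩ := hW.nonempty
    obtain ⟨c, hc, h⟩ := hW.exists_le_inner_of_mem hx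
    have h1 := h u hu
    have h2 := h _ hneg
    rw [inner_neg_right, norm_neg] at h2
    have : 0 < c * ‖u‖ := mul_pos hc (norm_pos_iff.2 h0)
    linarith

end IsOpenProperCone

/-! ### Order intervals and the function `Δ` -/

section Delta

variable {n : ℕ} {W : Set (EuclideanSpace ℝ (Fin n))}

lemma mem_coneInterval_zero {x y : EuclideanSpace ℝ (Fin n)} :
    y ∈ coneInterval W 0 x ↔ y ∈ W ∧ x - y ∈ W := by
  simp [coneInterval]

lemma measurable_coneDelta (hW : IsOpen W) : Measurable (coneDelta W) := by
  have hm : MeasurableSet {p : EuclideanSpace ℝ (Fin n) × EuclideanSpace ℝ (Fin n) |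
      p.2 ∈ W ∧ p.1 - p.2 ∈ W} :=
    ((hW.preimage continuous_snd).inter (hW.preimage (continuous_fst.sub continuous_snd))).measurableSet
  have := (measurable_measure_prodMk_left (ν := volume) hm).ennreal_toReal
  refine (congrArg Measurable (funext fun x => ?_)).mpr this
  rw [coneDelta]
  congr 2
  ext y
  exact mem_coneInterval_zero

lemma measurable_coneWeight (hW : IsOpen W) (s : ℝ) : Measurable (coneWeight W s) :=
  ((measurable_coneDelta hW).pow_const s).ennreal_ofReal

namespace IsOpenProperCone

/-- A functional in the dual cone is monotone for the cone order and controls the norm on the cone.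
-/
lemma exists_coneInterval_subset_ball (hW : IsOpenProperCone W) :
    ∃ R > 0, ∀ x, coneInterval W 0 x ⊆ Metric.closedBall 0 (R * ‖x‖) := by
  obtain ⟨u, hu⟩ := hW.openDualCone_nonempty
  obtain ⟨c, hc, h⟩ := hW.exists_le_inner hu
  refine ⟨‖u‖ / c + 1, by positivity, fun x y hy => ?_⟩
  rw [mem_coneInterval_zero] at hy
  have h1 := h y (subset_closure hy.1)
  have h2 := h _ (subset_closure hy.2)
  rw [inner_sub_right] at h2
  have h3 := real_inner_le_norm u x
  have h4 : 0 ≤ c * ‖x - y‖ := by positivity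
  rw [mem_closedBall_zero_iff, add_mul, div_mul_eq_mul_div, one_mul]
  have : ‖y‖ ≤ ‖u‖ * ‖x‖ / c := by
    rw [le_div_iff₀ hc]; linarith
  linarith [norm_nonneg x]

lemma volume_coneInterval_lt_top (hW : IsOpenProperCone W) (x : EuclideanSpace ℝ (Fin n)) :
    volume (coneInterval W 0 x) < ∞ := by
  obtain ⟨R, -, h⟩ := hW.exists_coneInterval_subset_ball
  exact (measure_mono (h x)).trans_lt measure_closedBall_lt_top

lemma isOpen_coneInterval (hW : IsOpenProperCone W) (a b : EuclideanSpace ℝ (Fin n)) :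
    IsOpen (coneInterval W a b) :=
  hW.isOpen.inter ((hW.isOpen.preimage (by fun_prop : Continuous fun x => x - a)).inter
    (hW.isOpen.preimage (by fun_prop : Continuous fun x => b - x)))

lemma coneDelta_pos (hW : IsOpenProperCone W) {x : EuclideanSpace ℝ (Fin n)} (hx : x ∈ W) :
    0 < coneDelta W x := by
  refine ENNReal.toReal_pos ?_ (hW.volume_coneInterval_lt_top x).ne
  refine ((hW.isOpen_coneInterval 0 x).measure_pos _ ⟨(1 / 2 : ℝ) • x, ?_⟩).ne'
  rw [mem_coneInterval_zero]
  refine ⟨hW.smul_mem x hx _ (by norm_num), ?_⟩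
  convert hW.smul_mem x hx (1 / 2) (by norm_num) using 1
  module

lemma coneDelta_le_of_sub_mem (hW : IsOpenProperCone W) {x y : EuclideanSpace ℝ (Fin n)}
    (hxy : y - x ∈ W) : coneDelta W x ≤ coneDelta W y := by
  refine ENNReal.toReal_mono (hW.volume_coneInterval_lt_top y).ne (measure_mono fun z hz => ?_)
  rw [mem_coneInterval_zero] at hz ⊢
  refine ⟨hz.1, ?_⟩
  convert hW.add_mem _ hxy _ hz.2 using 1
  abel

lemma exists_coneDelta_le (hW : IsOpenProperCone W) :
    ∃ C > 0, ∀ x, coneDelta W x ≤ C * ‖x‖ ^ n := by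
  obtain ⟨R, hR, h⟩ := hW.exists_coneInterval_subset_ball
  refine ⟨R ^ n * (volume (Metric.closedBall (0 : EuclideanSpace ℝ (Fin n)) 1)).toReal,
    mul_pos (by positivity) (ENNReal.toReal_pos
      (Metric.measure_closedBall_pos _ _ one_pos).ne' measure_closedBall_lt_top.ne), fun x => ?_⟩
  refine (ENNReal.toReal_mono measure_closedBall_lt_top.ne (measure_mono (h x))).trans_eq ?_
  rw [Measure.addHaar_closedBall' _ _ (by positivity), ENNReal.toReal_mul,
    ENNReal.toReal_ofReal (by positivity), finrank_euclideanSpace_fin, mul_pow]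
  ring

end IsOpenProperCone

end Delta

/-! ### Linear changes of variables -/

noncomputable section LinearChange

variable {n : ℕ}

/-- The adjoint of an invertible linear map, as an invertible linear map. -/
def adjointEquiv (A : EuclideanSpace ℝ (Fin n) ≃ₗ[ℝ] EuclideanSpace ℝ (Fin n)) :
    EuclideanSpace ℝ (Fin n) ≃ₗ[ℝ] EuclideanSpace ℝ (Fin n) :=
  LinearEquiv.ofLinearMap (LinearMap.adjoint A.toLinearMap) (LinearMap.adjoint A.symm.toLinearMap)
    (by rw [← LinearMap.adjoint_comp]; simp) (by rw [← LinearMap.adjoint_comp]; simp)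

lemma adjointEquiv_inner_left (A : EuclideanSpace ℝ (Fin n) ≃ₗ[ℝ] EuclideanSpace ℝ (Fin n))
    (x y : EuclideanSpace ℝ (Fin n)) :
    inner ℝ (adjointEquiv A x) y = inner ℝ x (A y) :=
  LinearMap.adjoint_inner_left A.toLinearMap y x

lemma adjointEquiv_inner_right (A : EuclideanSpace ℝ (Fin n) ≃ₗ[ℝ] EuclideanSpace ℝ (Fin n))
    (x y : EuclideanSpace ℝ (Fin n)) :
    inner ℝ x (adjointEquiv A y) = inner ℝ (A x) y :=
  LinearMap.adjoint_inner_right A.toLinearMap x y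

/-- The factor by which an invertible linear map scales Lebesgue measure. -/
def absDet (A : EuclideanSpace ℝ (Fin n) ≃ₗ[ℝ] EuclideanSpace ℝ (Fin n)) : ℝ :=
  |LinearMap.det (A : EuclideanSpace ℝ (Fin n) →ₗ[ℝ] EuclideanSpace ℝ (Fin n))|

lemma absDet_pos (A : EuclideanSpace ℝ (Fin n) ≃ₗ[ℝ] EuclideanSpace ℝ (Fin n)) :
    0 < absDet A :=
  abs_pos.2 A.isUnit_det'.ne_zero

lemma absDet_adjointEquiv (A : EuclideanSpace ℝ (Fin n) ≃ₗ[ℝ] EuclideanSpace ℝ (Fin n)) :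
    absDet (adjointEquiv A) = absDet A := by
  have h := LinearMap.toMatrix_adjoint (EuclideanSpace.basisFun (Fin n) ℝ)
    (EuclideanSpace.basisFun (Fin n) ℝ) A.toLinearMap
  have h' := congrArg Matrix.det h
  rw [Matrix.det_conjTranspose, LinearMap.det_toMatrix, LinearMap.det_toMatrix] at h'
  rw [star_trivial] at h'
  exact congrArg abs h'

lemma volume_image_linearEquiv (A : EuclideanSpace ℝ (Fin n) ≃ₗ[ℝ] EuclideanSpace ℝ (Fin n))
    (s : Set (EuclideanSpace ℝ (Fin n))) :
    volume (A '' s) = ENNReal.ofReal (absDet A) * volume s :=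
  Measure.addHaar_image_linearMap volume A.toLinearMap s

lemma hasFDerivWithinAt_linearEquiv
    (A : EuclideanSpace ℝ (Fin n) ≃ₗ[ℝ] EuclideanSpace ℝ (Fin n))
    (s : Set (EuclideanSpace ℝ (Fin n))) (x : EuclideanSpace ℝ (Fin n)) :
    HasFDerivWithinAt A (A.toContinuousLinearEquiv : _ →L[ℝ] _) s x :=
  A.toContinuousLinearEquiv.hasFDerivWithinAt

lemma lintegral_image_linearEquiv (A : EuclideanSpace ℝ (Fin n) ≃ₗ[ℝ] EuclideanSpace ℝ (Fin n))
    {s : Set (EuclideanSpace ℝ (Fin n))} (hs : MeasurableSet s)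
    (g : EuclideanSpace ℝ (Fin n) → ℝ≥0∞) :
    ∫⁻ x in A '' s, g x = ENNReal.ofReal (absDet A) * ∫⁻ x in s, g (A x) := by
  rw [lintegral_image_eq_lintegral_abs_det_fderiv_mul volume hs
    (fun x _ => hasFDerivWithinAt_linearEquiv A s x) A.injective.injOn]
  exact lintegral_const_mul' _ _ ENNReal.ofReal_ne_top

lemma integral_image_linearEquiv (A : EuclideanSpace ℝ (Fin n) ≃ₗ[ℝ] EuclideanSpace ℝ (Fin n))
    {s : Set (EuclideanSpace ℝ (Fin n))} (hs : MeasurableSet s)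
    (g : EuclideanSpace ℝ (Fin n) → ℝ) :
    ∫ x in A '' s, g x = absDet A * ∫ x in s, g (A x) := by
  rw [integral_image_eq_integral_abs_det_fderiv_smul volume hs
    (fun x _ => hasFDerivWithinAt_linearEquiv A s x) A.injective.injOn]
  exact integral_const_mul _ _

end LinearChange

/-! ### Behaviour under automorphisms of the cone -/

section Automorphism

variable {n : ℕ} {V : Set (EuclideanSpace ℝ (Fin n))}
  {A : EuclideanSpace ℝ (Fin n) ≃ₗ[ℝ] EuclideanSpace ℝ (Fin n)}

lemma image_symm_eq (hA : A '' V = V) : A.symm '' V = V := by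
  conv_lhs => rw [← hA]
  rw [Set.image_image]
  simp

lemma mem_iff_of_image_eq (hA : A '' V = V) {x : EuclideanSpace ℝ (Fin n)} :
    A x ∈ V ↔ x ∈ V := by
  conv_lhs => rw [← hA]
  exact A.injective.mem_set_image

lemma mem_closure_of_image_eq (hA : A '' V = V) {x : EuclideanSpace ℝ (Fin n)}
    (hx : x ∈ closure V) : A x ∈ closure V := by
  have := A.toContinuousLinearEquiv.toHomeomorph.image_closure V
  have h2 : A x ∈ closure (A '' V) := this ▸ ⟨x, hx, rfl⟩
  rwa [hA] at h2

lemma adjointEquiv_mem_openDualCone (hA : A '' V = V) {u : EuclideanSpace ℝ (Fin n)}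
    (hu : u ∈ openDualCone V) : adjointEquiv A u ∈ openDualCone V := fun y hy h0 => by
  rw [adjointEquiv_inner_left]
  exact hu _ (mem_closure_of_image_eq hA hy) (by simpa using h0)

lemma adjointEquiv_image_openDualCone (hA : A '' V = V) :
    adjointEquiv A '' openDualCone V = openDualCone V := by
  refine Set.Subset.antisymm (Set.image_subset_iff.2 fun u hu =>
    adjointEquiv_mem_openDualCone hA hu) fun u hu =>
    ⟨(adjointEquiv A).symm u, ?_, LinearEquiv.apply_symm_apply _ _⟩
  have h : (adjointEquiv A).symm = adjointEquiv A.symm := by ext1; rfl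
  rw [h]
  exact adjointEquiv_mem_openDualCone (image_symm_eq hA) hu

lemma coneDelta_map (hA : A '' V = V) (x : EuclideanSpace ℝ (Fin n)) :
    coneDelta V (A x) = absDet A * coneDelta V x := by
  have h : coneInterval V 0 (A x) = A '' coneInterval V 0 x := by
    ext z
    constructor
    · intro hz
      rw [mem_coneInterval_zero] at hz
      refine ⟨A.symm z, ?_, by simp⟩
      rw [mem_coneInterval_zero, ← mem_iff_of_image_eq hA, ← mem_iff_of_image_eq hA (x := x - _)]
      simpa using hz
    · rintro ⟨y, hy, rfl⟩
      rw [mem_coneInterval_zero] at hy ⊢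
      rwa [← map_sub, mem_iff_of_image_eq hA, mem_iff_of_image_eq hA]
  rw [coneDelta, h, volume_image_linearEquiv, ENNReal.toReal_mul,
    ENNReal.toReal_ofReal (absDet_pos A).le, coneDelta]

/-- Homotheties are automorphisms of every cone, with determinant `r ^ n`. -/
lemma coneDelta_smul {W : Set (EuclideanSpace ℝ (Fin n))} (hW : IsOpenProperCone W) {r : ℝ}
    (hr : 0 < r) (x : EuclideanSpace ℝ (Fin n)) :
    coneDelta W (r • x) = r ^ n * coneDelta W x := by
  have hA : LinearEquiv.smulOfUnit (M := EuclideanSpace ℝ (Fin n)) (Units.mk0 r hr.ne') '' W = W := by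
    refine Set.Subset.antisymm (Set.image_subset_iff.2 fun u hu => hW.smul_mem u hu r hr)
      fun u hu => ⟨r⁻¹ • u, hW.smul_mem u hu _ (inv_pos.2 hr), ?_⟩
    exact smul_inv_smul₀ hr.ne' u
  have h : absDet (LinearEquiv.smulOfUnit (M := EuclideanSpace ℝ (Fin n)) (Units.mk0 r hr.ne'))
      = r ^ n := by
    have : ((LinearEquiv.smulOfUnit (M := EuclideanSpace ℝ (Fin n)) (Units.mk0 r hr.ne') :
      EuclideanSpace ℝ (Fin n) ≃ₗ[ℝ] EuclideanSpace ℝ (Fin n)) :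
      EuclideanSpace ℝ (Fin n) →ₗ[ℝ] EuclideanSpace ℝ (Fin n)) = r • LinearMap.id := rfl
    rw [absDet, this, LinearMap.det_smul, LinearMap.det_id, finrank_euclideanSpace_fin, mul_one,
      abs_of_pos (by positivity)]
  rw [← h]
  exact coneDelta_map hA x

/-- The adjoint of `A` preserves the dual cone, so it serves as a change of variables in the
defining integral. -/
lemma coneCharFun_map (hV : IsOpenProperCone V) (hA : A '' V = V)
    (x : EuclideanSpace ℝ (Fin n)) :
    coneCharFun V x = absDet A * coneCharFun V (A x) := by
  rw [coneCharFun]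
  conv_lhs => rw [← adjointEquiv_image_openDualCone hA]
  rw [integral_image_linearEquiv _ hV.isOpen_openDualCone.measurableSet, absDet_adjointEquiv]
  simp_rw [adjointEquiv_inner_right]
  rfl

end Automorphism

/-! ### The map `x ↦ x*` -/

section Star

variable {n : ℕ} {V : Set (EuclideanSpace ℝ (Fin n))}

lemma integrable_norm_mul_exp_neg_mul_norm {c : ℝ} (hc : 0 < c) (k : ℕ) :
    Integrable fun u : EuclideanSpace ℝ (Fin n) => ‖u‖ ^ k * Real.exp (-(c * ‖u‖)) := by
  rcases n.eq_zero_or_pos with rfl | hn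
  · exact Continuous.integrable_of_hasCompactSupport (by fun_prop)
      (HasCompactSupport.of_compactSpace _)
  have : Nontrivial (EuclideanSpace ℝ (Fin n)) := by
    have : Nonempty (Fin n) := ⟨⟨0, hn⟩⟩
    infer_instance
  rw [integrable_fun_norm_addHaar volume (f := fun r => r ^ k * Real.exp (-(c * r)))]
  have h := integrableOn_rpow_mul_exp_neg_mul_rpow (p := 1) (s := (n - 1 + k : ℕ)) (b := c)
    (by have : (0 : ℝ) ≤ (n - 1 + k : ℕ) := Nat.cast_nonneg _
        linarith) one_pos hc
  refine h.congr_fun (fun r hr => ?_) measurableSet_Ioi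
  simp only [Real.rpow_natCast, Real.rpow_one, finrank_euclideanSpace_fin, smul_eq_mul]
  rw [pow_add, neg_mul, mul_assoc]

namespace IsOpenProperCone

/-- Coercivity uniform near `x` supplies the domination for differentiating `φ_V` under the integral
sign. -/
lemma exists_ball_le_inner (hV : IsOpenProperCone V) {x : EuclideanSpace ℝ (Fin n)} (hx : x ∈ V) :
    ∃ c > 0, ∀ z ∈ Metric.ball x c, ∀ u ∈ openDualCone V, c * ‖u‖ ≤ inner ℝ z u := by
  obtain ⟨c, hc, h⟩ := hV.exists_le_inner_of_mem hx
  refine ⟨c / 2, by positivity, fun z hz u hu => ?_⟩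
  have h1 := h u (subset_closure hu)
  have h2 := (abs_le.1 (abs_real_inner_le_norm (z - x) u)).1
  rw [inner_sub_left] at h2
  have h3 : ‖z - x‖ * ‖u‖ ≤ c / 2 * ‖u‖ := by
    gcongr; exact (mem_ball_iff_norm.1 hz).le
  linarith

lemma integrableOn_exp_neg_inner (hV : IsOpenProperCone V) {x : EuclideanSpace ℝ (Fin n)}
    (hx : x ∈ V) (k : ℕ) :
    IntegrableOn (fun u => ‖u‖ ^ k * Real.exp (-(inner ℝ x u))) (openDualCone V) := by
  obtain ⟨c, hc, h⟩ := hV.exists_le_inner_of_mem hx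
  refine Integrable.mono' (integrable_norm_mul_exp_neg_mul_norm hc k).integrableOn
    (by fun_prop : Continuous _).aestronglyMeasurable ?_
  filter_upwards [ae_restrict_mem hV.isOpen_openDualCone.measurableSet] with u hu
  rw [Real.norm_of_nonneg (by positivity)]
  gcongr
  exact h u (subset_closure hu)

lemma integrableOn_exp_neg_inner' (hV : IsOpenProperCone V) {x : EuclideanSpace ℝ (Fin n)}
    (hx : x ∈ V) : IntegrableOn (fun u => Real.exp (-(inner ℝ x u))) (openDualCone V) := by
  simpa using hV.integrableOn_exp_neg_inner hx 0

lemma setIntegral_openDualCone_pos (hV : IsOpenProperCone V)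
    {f : EuclideanSpace ℝ (Fin n) → ℝ} (hf : IntegrableOn f (openDualCone V))
    (hpos : ∀ u ∈ openDualCone V, 0 < f u) : 0 < ∫ u in openDualCone V, f u := by
  have hm := hV.isOpen_openDualCone.measurableSet
  rw [setIntegral_pos_iff_support_of_nonneg_ae
    (by filter_upwards [ae_restrict_mem hm] with u hu using (hpos u hu).le) hf,
    Set.inter_eq_self_of_subset_right
      (show openDualCone V ⊆ Function.support f from fun u hu => (hpos u hu).ne')]
  exact hV.isOpen_openDualCone.measure_pos _ hV.openDualCone_nonempty

lemma coneCharFun_pos (hV : IsOpenProperCone V) {x : EuclideanSpace ℝ (Fin n)} (hx : x ∈ V) :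
    0 < coneCharFun V x :=
  hV.setIntegral_openDualCone_pos (hV.integrableOn_exp_neg_inner' hx)
    fun _ _ => Real.exp_pos _

lemma hasFDerivAt_coneCharFun (hV : IsOpenProperCone V) {x : EuclideanSpace ℝ (Fin n)}
    (hx : x ∈ V) :
    HasFDerivAt (coneCharFun V)
      (∫ u in openDualCone V, -(Real.exp (-(inner ℝ x u)) • innerSL ℝ u)) x := by
  obtain ⟨c, hc, h⟩ := hV.exists_ball_le_inner hx
  refine hasFDerivAt_integral_of_dominated_of_fderiv_le (Metric.ball_mem_nhds x hc)
    (bound := fun u => ‖u‖ ^ 1 * Real.exp (-(c * ‖u‖)))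
    (F' := fun z u => -(Real.exp (-(inner ℝ z u)) • innerSL ℝ u))
    (Filter.Eventually.of_forall fun z =>
      (by fun_prop : Continuous fun u => Real.exp (-(inner ℝ z u))).aestronglyMeasurable)
    (hV.integrableOn_exp_neg_inner' hx)
    (by fun_prop : Continuous fun u : EuclideanSpace ℝ (Fin n) =>
      -(Real.exp (-(inner ℝ x u)) • innerSL ℝ u)).aestronglyMeasurable ?_
    (integrable_norm_mul_exp_neg_mul_norm hc 1).integrableOn ?_
  · filter_upwards [ae_restrict_mem hV.isOpen_openDualCone.measurableSet] with u hu z hz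
    rw [norm_neg, norm_smul, innerSL_apply_norm, Real.norm_of_nonneg (by positivity), mul_comm,
      pow_one]
    gcongr
    exact h z hz u hu
  · refine Filter.Eventually.of_forall fun u z _ => ?_
    have h1 : HasFDerivAt (fun z : EuclideanSpace ℝ (Fin n) => -(inner ℝ z u)) (-innerSL ℝ u) z := by
      have : HasFDerivAt (fun z => inner ℝ u z) (innerSL ℝ u) z := (innerSL ℝ u).hasFDerivAt
      refine (this.congr_of_eventuallyEq (Filter.Eventually.of_forall fun z => ?_)).neg
      exact real_inner_comm u z
    simpa using h1.exp

/-- Thus `x*` is the barycentre of `V*` for the probability density proportional to `e^{-x·u}`,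
which is why it lies in `V*`. -/
lemma inner_coneStar (hV : IsOpenProperCone V) {x : EuclideanSpace ℝ (Fin n)} (hx : x ∈ V)
    (y : EuclideanSpace ℝ (Fin n)) :
    inner ℝ (coneStar V x) y =
      (coneCharFun V x)⁻¹ * ∫ u in openDualCone V, Real.exp (-(inner ℝ x u)) * inner ℝ u y := by
  have hi : IntegrableOn (fun u => -(Real.exp (-(inner ℝ x u)) • innerSL ℝ u))
      (openDualCone V) := by
    refine Integrable.mono' (hV.integrableOn_exp_neg_inner hx 1)
      (by fun_prop : Continuous fun u : EuclideanSpace ℝ (Fin n) =>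
        -(Real.exp (-(inner ℝ x u)) • innerSL ℝ u)).aestronglyMeasurable
      (Filter.Eventually.of_forall fun u => ?_)
    rw [norm_neg, norm_smul, innerSL_apply_norm, Real.norm_of_nonneg (by positivity), mul_comm,
      pow_one]
  rw [coneStar, inner_neg_left, inner_gradient_left,
    ((hV.hasFDerivAt_coneCharFun hx).log (hV.coneCharFun_pos hx).ne').fderiv,
    smul_apply, ContinuousLinearMap.integral_apply hi, smul_eq_mul,
    ← mul_neg, ← integral_neg]
  simp

lemma coneStar_mem_openDualCone (hV : IsOpenProperCone V) {x : EuclideanSpace ℝ (Fin n)}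
    (hx : x ∈ V) : coneStar V x ∈ openDualCone V := fun y hy h0 => by
  rw [hV.inner_coneStar hx]
  refine mul_pos (inv_pos.2 (hV.coneCharFun_pos hx)) (hV.setIntegral_openDualCone_pos ?_
    fun u hu => mul_pos (Real.exp_pos _) (hu y hy h0))
  refine Integrable.mono' ((hV.integrableOn_exp_neg_inner hx 1).mul_const ‖y‖)
    (by fun_prop : Continuous _).aestronglyMeasurable (Filter.Eventually.of_forall fun u => ?_)
  rw [norm_mul, Real.norm_of_nonneg (by positivity), pow_one, mul_comm ‖u‖, mul_assoc]
  gcongr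
  exact norm_inner_le_norm u y

/-- Near `x`, `log φ_V` and `log φ_V ∘ A` differ by the constant `log |det A|`, which disappears on
differentiation. -/
lemma inner_coneStar_map (hV : IsOpenProperCone V)
    {A : EuclideanSpace ℝ (Fin n) ≃ₗ[ℝ] EuclideanSpace ℝ (Fin n)} (hA : A '' V = V)
    {x : EuclideanSpace ℝ (Fin n)} (hx : x ∈ V) (y : EuclideanSpace ℝ (Fin n)) :
    inner ℝ (coneStar V (A x)) (A y) = inner ℝ (coneStar V x) y := by
  have h : (fun z => Real.log (coneCharFun V z)) =ᶠ[nhds x]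
      fun z => Real.log (absDet A) + Real.log (coneCharFun V (A z)) := by
    filter_upwards [hV.isOpen.mem_nhds hx] with z hz
    rw [coneCharFun_map hV hA z, Real.log_mul (absDet_pos A).ne'
      (hV.coneCharFun_pos ((mem_iff_of_image_eq hA).2 hz)).ne']
  have h2 := A.toContinuousLinearEquiv.comp_right_fderiv
    (f := fun z => Real.log (coneCharFun V z)) (x := x)
  rw [coneStar, coneStar, inner_neg_left, inner_neg_left, inner_gradient_left, inner_gradient_left,
    h.fderiv_eq, fderiv_const_add]
  exact congrArg (fun f => -(f y)) h2.symm

lemma adjointEquiv_coneStar (hV : IsOpenProperCone V)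
    {A : EuclideanSpace ℝ (Fin n) ≃ₗ[ℝ] EuclideanSpace ℝ (Fin n)} (hA : A '' V = V)
    {x : EuclideanSpace ℝ (Fin n)} (hx : x ∈ V) :
    adjointEquiv A (coneStar V (A x)) = coneStar V x :=
  ext_inner_right ℝ fun y => by rw [adjointEquiv_inner_left, hV.inner_coneStar_map hA hx]

end IsOpenProperCone

lemma measurable_coneStar (V : Set (EuclideanSpace ℝ (Fin n))) : Measurable (coneStar V) :=
  ((InnerProductSpace.toDual ℝ _).symm.continuous.measurable.comp (measurable_fderiv ℝ _)).neg

end Star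

/-! ### The exponent `σ` and integrability of powers of `Δ` -/

section Sigma

variable {n : ℕ} {W : Set (EuclideanSpace ℝ (Fin n))}

lemma coneSigmaZero_nonpos (W : Set (EuclideanSpace ℝ (Fin n))) : coneSigmaZero W ≤ 0 := by
  refine sInf_le ⟨0, ?_, by simp⟩
  simp only [Set.mem_ofPred_eq, coneSphereIntegral, Real.rpow_zero, ENNReal.ofReal_one]
  rw [lintegral_one]
  exact measure_lt_top _ _

lemma coe_coneSigma (W : Set (EuclideanSpace ℝ (Fin n))) :
    (coneSigma W : EReal) = max (-1) (coneSigmaZero W) := by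
  refine EReal.coe_toReal (fun h => ?_) (fun h => ?_)
  · have : max (-1) (coneSigmaZero W) ≤ 0 := max_le (by norm_num) (coneSigmaZero_nonpos W)
    rw [h] at this
    exact absurd this (by simp)
  · have : (-1 : EReal) ≤ max (-1) (coneSigmaZero W) := le_max_left _ _
    rw [h] at this
    exact absurd (le_bot_iff.1 this) (by simpa using EReal.coe_ne_bot (-1))

lemma neg_one_le_coneSigma (W : Set (EuclideanSpace ℝ (Fin n))) : -1 ≤ coneSigma W := by
  have : ((-1 : ℝ) : EReal) ≤ coneSigma W := by
    rw [coe_coneSigma]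
    simp
  exact_mod_cast this

/-- Since `Δ_W` is bounded on the unit sphere, finiteness at one exponent passes to every larger
one. -/
lemma IsOpenProperCone.coneSphereIntegral_lt_top (hW : IsOpenProperCone W) {β : ℝ}
    (hβ : coneSigma W < β) : coneSphereIntegral W β < ∞ := by
  have h : coneSigmaZero W < (β : EReal) := by
    have : (coneSigma W : EReal) < β := by exact_mod_cast hβ
    rw [coe_coneSigma] at this
    exact (le_max_right _ _).trans_lt this
  obtain ⟨_, ⟨α, hα, rfl⟩, hαβ⟩ := sInf_lt_iff.1 h
  have hαβ : α < β := EReal.coe_lt_coe_iff.1 hαβ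
  obtain ⟨C, hC, hb⟩ := hW.exists_coneDelta_le
  have hm : MeasurableSet {t : Metric.sphere (0 : EuclideanSpace ℝ (Fin n)) 1 |
      (t : EuclideanSpace ℝ (Fin n)) ∈ W} :=
    (hW.isOpen.preimage continuous_subtype_val).measurableSet
  have key : coneSphereIntegral W β ≤ ENNReal.ofReal (C ^ (β - α)) * coneSphereIntegral W α := by
    rw [coneSphereIntegral, coneSphereIntegral, ← lintegral_const_mul' _ _ ENNReal.ofReal_ne_top]
    refine setLIntegral_mono' hm fun t ht => ?_
    have hpos := hW.coneDelta_pos ht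
    rw [← ENNReal.ofReal_mul (by positivity)]
    refine ENNReal.ofReal_le_ofReal ?_
    have : coneDelta W t ≤ C := by simpa using hb t
    calc coneDelta W t ^ β = coneDelta W t ^ (β - α) * coneDelta W t ^ α := by
          rw [← Real.rpow_add hpos]; ring_nf
      _ ≤ _ := by
          gcongr
  exact key.trans_lt (ENNReal.mul_lt_top ENNReal.ofReal_lt_top hα)

/-- Polar coordinates; the origin omitted by them is a null set. -/
lemma lintegral_eq_lintegral_sphere_prod [Nontrivial (EuclideanSpace ℝ (Fin n))]
    (G : EuclideanSpace ℝ (Fin n) → ℝ≥0∞) :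
    ∫⁻ x, G x = ∫⁻ p, G (p.2.1 • p.1.1)
      ∂((volume : Measure (EuclideanSpace ℝ (Fin n))).toSphere.prod
        (Measure.volumeIoiPow (n - 1))) := by
  have h := (Measure.measurePreserving_homeomorphUnitSphereProd
    (volume : Measure (EuclideanSpace ℝ (Fin n)))).lintegral_comp_emb
    (Homeomorph.measurableEmbedding _) (fun p => G (p.2.1 • p.1.1))
  rw [finrank_euclideanSpace_fin] at h
  rw [← h]
  have h2 : ∀ a : ({0}ᶜ : Set (EuclideanSpace ℝ (Fin n))),
      ((homeomorphUnitSphereProd _ a).2.1 • (homeomorphUnitSphereProd _ a).1.1) = a.1 := fun a => by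
    have ha : ‖a.1‖ ≠ 0 := norm_ne_zero_iff.2 a.2
    simp [smul_smul, ha]
  simp_rw [h2]
  rw [lintegral_subtype_comap (measurableSet_singleton _).compl, restrict_compl_singleton]

lemma lintegral_volumeIoiPow_lt_top {k : ℕ} {s c : ℝ} (hs : -1 < k + s) (hc : 0 < c) :
    ∫⁻ r, ENNReal.ofReal (Real.exp (-(c * r.1)) * r.1 ^ s) ∂(Measure.volumeIoiPow k) < ∞ := by
  rw [Measure.volumeIoiPow, lintegral_withDensity_eq_lintegral_mul₀
    (by fun_prop) (by fun_prop)]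
  have := lintegral_subtype_comap (μ := volume) (measurableSet_Ioi (a := (0 : ℝ)))
    (fun r : ℝ => ENNReal.ofReal (r ^ k) * ENNReal.ofReal (Real.exp (-(c * r)) * r ^ s))
  refine this.trans_lt ?_
  have hi := integrableOn_rpow_mul_exp_neg_mul_rpow (p := 1) (s := k + s) (b := c) hs one_pos hc
  refine lt_of_eq_of_lt (setLIntegral_congr_fun measurableSet_Ioi fun r hr => ?_)
    hi.lintegral_lt_top
  have hr : 0 < r := hr
  rw [← ENNReal.ofReal_mul (by positivity), Real.rpow_one, Real.rpow_add hr, Real.rpow_natCast]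
  ring_nf

/-- Above the critical exponent `σ(W)`, powers of `Δ_W` are integrable against exponentials. -/
lemma IsOpenProperCone.lintegral_exp_norm_mul_coneWeight_lt_top (hW : IsOpenProperCone W) {β c : ℝ}
    (hβ : coneSigma W < β) (hc : 0 < c) :
    ∫⁻ t in W, ENNReal.ofReal (Real.exp (-(c * ‖t‖))) * coneWeight W β t < ∞ := by
  -- In dimension zero there are no polar coordinates, but the space is a single point of finite
  -- measure.
  rcases n.eq_zero_or_pos with rfl | hn
  · have : ∀ t : EuclideanSpace ℝ (Fin 0), t = 0 := fun t => Subsingleton.elim _ _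
    simp_rw [fun t : EuclideanSpace ℝ (Fin 0) => congrArg (fun t =>
      ENNReal.ofReal (Real.exp (-(c * ‖t‖))) * coneWeight W β t) (this t)]
    rw [lintegral_const]
    exact ENNReal.mul_lt_top (ENNReal.mul_lt_top ENNReal.ofReal_lt_top ENNReal.ofReal_lt_top)
      (by rw [Measure.restrict_apply_univ]; exact (Set.toFinite W).isCompact.measure_lt_top)
  have : Nontrivial (EuclideanSpace ℝ (Fin n)) := by
    have : Nonempty (Fin n) := ⟨⟨0, hn⟩⟩
    infer_instance
  have hm : MeasurableSet {t : Metric.sphere (0 : EuclideanSpace ℝ (Fin n)) 1 |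
      (t : EuclideanSpace ℝ (Fin n)) ∈ W} :=
    (hW.isOpen.preimage continuous_subtype_val).measurableSet
  rw [← lintegral_indicator hW.isOpen.measurableSet, lintegral_eq_lintegral_sphere_prod]
  -- `Δ_W` is homogeneous of degree `n`, so the integrand splits into an angular and a radial
  -- factor.
  have h : ∀ p : Metric.sphere (0 : EuclideanSpace ℝ (Fin n)) 1 × Set.Ioi (0 : ℝ),
      W.indicator (fun t => ENNReal.ofReal (Real.exp (-(c * ‖t‖))) * coneWeight W β t)
        (p.2.1 • p.1.1) =
      {t : Metric.sphere (0 : EuclideanSpace ℝ (Fin n)) 1 |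
        (t : EuclideanSpace ℝ (Fin n)) ∈ W}.indicator
          (fun t => ENNReal.ofReal (coneDelta W t ^ β)) p.1 *
        ENNReal.ofReal (Real.exp (-(c * p.2.1)) * p.2.1 ^ (n * β)) := by
    rintro ⟨θ, r, hr⟩
    have hr : 0 < r := hr
    have hiff : r • (θ : EuclideanSpace ℝ (Fin n)) ∈ W ↔ (θ : EuclideanSpace ℝ (Fin n)) ∈ W := by
      refine ⟨fun h => ?_, fun h => hW.smul_mem _ h r hr⟩
      simpa [smul_smul, hr.ne'] using hW.smul_mem _ h r⁻¹ (inv_pos.2 hr)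
    by_cases hθ : (θ : EuclideanSpace ℝ (Fin n)) ∈ W
    · rw [Set.indicator_of_mem (hiff.2 hθ), Set.indicator_of_mem (by exact hθ), coneWeight,
        coneDelta_smul hW hr, norm_smul, Real.norm_of_nonneg hr.le,
        norm_eq_of_mem_sphere θ, mul_one, Real.mul_rpow (by positivity) (hW.coneDelta_pos hθ).le,
        ← Real.rpow_natCast, ← Real.rpow_mul hr.le, ENNReal.ofReal_mul (by positivity),
        ENNReal.ofReal_mul (by positivity)]
      ring
    · rw [Set.indicator_of_notMem (mt hiff.1 hθ), Set.indicator_of_notMem (by exact hθ), zero_mul]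
  simp_rw [h]
  have hd : Measurable fun t : Metric.sphere (0 : EuclideanSpace ℝ (Fin n)) 1 =>
      ENNReal.ofReal (coneDelta W t ^ β) :=
    (measurable_coneWeight hW.isOpen β).comp measurable_subtype_coe
  rw [lintegral_prod_mul (g := fun r : Set.Ioi (0 : ℝ) =>
      ENNReal.ofReal (Real.exp (-(c * r.1)) * r.1 ^ (n * β)))
    (hd.indicator hm).aemeasurable (by fun_prop), lintegral_indicator hm]
  refine ENNReal.mul_lt_top (hW.coneSphereIntegral_lt_top hβ)
    (lintegral_volumeIoiPow_lt_top ?_ hc)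
  -- The radial integral converges when `n - 1 + nβ > -1`, that is `β > -1`: this is the role of the
  -- truncation at `-1` in `σ`.
  have h1 : -1 < β := (neg_one_le_coneSigma W).trans_lt hβ
  have hn' : (0 : ℝ) < n := by exact_mod_cast hn
  rw [Nat.cast_pred hn]
  nlinarith

lemma IsOpenProperCone.lintegral_exp_mul_coneWeight_lt_top (hW : IsOpenProperCone W) {β c : ℝ}
    (hβ : coneSigma W < β) (hc : 0 < c) {ξ : EuclideanSpace ℝ (Fin n)}
    (hξ : ∀ t ∈ W, c * ‖t‖ ≤ inner ℝ ξ t) :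
    ∫⁻ t in W, ENNReal.ofReal (Real.exp (-(inner ℝ ξ t))) * coneWeight W β t < ∞ := by
  refine (setLIntegral_mono' hW.isOpen.measurableSet fun t ht => ?_).trans_lt
    (hW.lintegral_exp_norm_mul_coneWeight_lt_top hβ hc)
  gcongr
  exact hξ t ht

end Sigma

/-! ### The invariant measure and the invariant kernel -/

noncomputable section Kernel

variable {n : ℕ} {V : Set (EuclideanSpace ℝ (Fin n))}

/-- The measure `Δ_V(x)⁻¹ dx` on `V`, invariant under the automorphisms of `V`. -/
def coneInvMeasure (V : Set (EuclideanSpace ℝ (Fin n))) : Measure (EuclideanSpace ℝ (Fin n)) :=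
  (volume.restrict V).withDensity (coneWeight V (-1))

/-- The automorphism invariant kernel `e^{-c x*·y} (Δ_V(y) / Δ_V(x))^b`. -/
def coneKernel (V : Set (EuclideanSpace ℝ (Fin n))) (c b : ℝ)
    (x y : EuclideanSpace ℝ (Fin n)) : ℝ≥0∞ :=
  ENNReal.ofReal (Real.exp (-(c * inner ℝ (coneStar V x) y)) *
    (coneDelta V y / coneDelta V x) ^ b)

lemma coneDelta_nonneg (V : Set (EuclideanSpace ℝ (Fin n))) (x : EuclideanSpace ℝ (Fin n)) :
    0 ≤ coneDelta V x := ENNReal.toReal_nonneg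

namespace IsOpenProperCone

lemma lintegral_coneInvMeasure (hV : IsOpenProperCone V) (g : EuclideanSpace ℝ (Fin n) → ℝ≥0∞) :
    ∫⁻ x, g x ∂(coneInvMeasure V) = ∫⁻ x in V, coneWeight V (-1) x * g x :=
  lintegral_withDensity_eq_lintegral_mul_non_measurable₀ _
    (measurable_coneWeight hV.isOpen _).aemeasurable
    (Filter.Eventually.of_forall fun _ => ENNReal.ofReal_lt_top) g

instance sigmaFinite_coneInvMeasure : SigmaFinite (coneInvMeasure V) :=
  inferInstanceAs (SigmaFinite ((volume.restrict V).withDensity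
    (fun x => ENNReal.ofReal (coneDelta V x ^ (-1 : ℝ)))))

lemma ae_mem_coneInvMeasure (hV : IsOpenProperCone V) : ∀ᵐ x ∂(coneInvMeasure V), x ∈ V :=
  (withDensity_absolutelyContinuous _ _).ae_le (ae_restrict_mem hV.isOpen.measurableSet)

lemma lintegral_coneInvMeasure_map (hV : IsOpenProperCone V)
    {A : EuclideanSpace ℝ (Fin n) ≃ₗ[ℝ] EuclideanSpace ℝ (Fin n)} (hA : A '' V = V)
    (g : EuclideanSpace ℝ (Fin n) → ℝ≥0∞) :
    ∫⁻ x, g (A x) ∂(coneInvMeasure V) = ∫⁻ x, g x ∂(coneInvMeasure V) := by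
  rw [hV.lintegral_coneInvMeasure, hV.lintegral_coneInvMeasure]
  conv_rhs => rw [← hA]
  rw [lintegral_image_linearEquiv A hV.isOpen.measurableSet,
    ← lintegral_const_mul' _ _ ENNReal.ofReal_ne_top]
  congr 1 with x
  have hd := absDet_pos A
  rw [← mul_assoc, hA, coneWeight, coneWeight, ← ENNReal.ofReal_mul hd.le, coneDelta_map hA,
    Real.rpow_neg_one, Real.rpow_neg_one, mul_inv, ← mul_assoc, mul_inv_cancel₀ hd.ne', one_mul]

lemma coneKernel_map (hV : IsOpenProperCone V)
    {A : EuclideanSpace ℝ (Fin n) ≃ₗ[ℝ] EuclideanSpace ℝ (Fin n)} (hA : A '' V = V)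
    {x : EuclideanSpace ℝ (Fin n)} (hx : x ∈ V) (y : EuclideanSpace ℝ (Fin n)) (c b : ℝ) :
    coneKernel V c b (A x) (A y) = coneKernel V c b x y := by
  rw [coneKernel, coneKernel, hV.inner_coneStar_map hA hx, coneDelta_map hA, coneDelta_map hA,
    mul_div_mul_left _ _ (absDet_pos A).ne']

lemma measurable_coneKernel (hV : IsOpenProperCone V) (c b : ℝ) :
    Measurable fun p : EuclideanSpace ℝ (Fin n) × EuclideanSpace ℝ (Fin n) =>
      coneKernel V c b p.1 p.2 := by
  have h1 := measurable_coneStar V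
  have h2 := measurable_coneDelta hV.isOpen
  unfold coneKernel
  fun_prop

lemma coneKernel_mul (hV : IsOpenProperCone V) {x y : EuclideanSpace ℝ (Fin n)} (hx : x ∈ V)
    (hy : y ∈ V) (c c' b b' : ℝ) :
    coneKernel V c b x y * coneKernel V c' b' x y = coneKernel V (c + c') (b + b') x y := by
  have h1 := hV.coneDelta_pos hx
  have h2 := hV.coneDelta_pos hy
  rw [coneKernel, coneKernel, coneKernel, ← ENNReal.ofReal_mul (by positivity),
    Real.rpow_add (by positivity), add_mul, neg_add, Real.exp_add]
  ring_nf

lemma coneKernel_rpow (hV : IsOpenProperCone V) {x y : EuclideanSpace ℝ (Fin n)} (hx : x ∈ V)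
    (hy : y ∈ V) (c b : ℝ) {r : ℝ} (hr : 0 ≤ r) :
    coneKernel V c b x y ^ r = coneKernel V (c * r) (b * r) x y := by
  have h1 := hV.coneDelta_pos hx
  have h2 := hV.coneDelta_pos hy
  rw [coneKernel, coneKernel, ENNReal.ofReal_rpow_of_nonneg (by positivity) hr,
    Real.mul_rpow (by positivity) (by positivity), ← Real.exp_mul,
    ← Real.rpow_mul (by positivity)]
  ring_nf

end IsOpenProperCone

namespace IsHomogeneousCone

/-- Invariance of kernel and measure makes the integral independent of `x`, so finiteness at one
point suffices. -/
lemma exists_lintegral_coneKernel_le (hV : IsHomogeneousCone V) {c b : ℝ} (hc : 0 < c)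
    (hb : coneSigma V + 1 < b) :
    ∃ C : ℝ≥0, ∀ x ∈ V, ∫⁻ y, coneKernel V c b x y ∂(coneInvMeasure V) ≤ C := by
  have hP := hV.toIsOpenProperCone
  obtain ⟨x₀, hx₀⟩ := hV.nonempty
  have hfin : ∫⁻ y, coneKernel V c b x₀ y ∂(coneInvMeasure V) < ∞ := by
    have hpos := hP.coneDelta_pos hx₀
    obtain ⟨d, hd, h⟩ := hP.exists_le_inner (hP.coneStar_mem_openDualCone hx₀)
    -- The exponent is `b - 1` because the invariant measure contributes `Δ_V⁻¹`.
    have key := hP.lintegral_exp_mul_coneWeight_lt_top (β := b - 1) (c := c * d)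
      (ξ := c • coneStar V x₀) (by linarith) (by positivity) fun t ht => by
        rw [inner_smul_left, mul_assoc]
        exact mul_le_mul_of_nonneg_left (h t (subset_closure ht)) hc.le
    rw [hP.lintegral_coneInvMeasure]
    refine lt_of_eq_of_lt ?_ (ENNReal.mul_lt_top
      (ENNReal.ofReal_lt_top (r := coneDelta V x₀ ^ (-b))) key)
    rw [← lintegral_const_mul' _ _ ENNReal.ofReal_ne_top]
    refine setLIntegral_congr_fun hP.isOpen.measurableSet fun y hy => ?_
    have hy := hP.coneDelta_pos hy
    rw [coneWeight, coneWeight, coneKernel, ← ENNReal.ofReal_mul (by positivity),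
      ← ENNReal.ofReal_mul (by positivity), ← ENNReal.ofReal_mul (by positivity),
      Real.div_rpow hy.le hpos.le, Real.rpow_neg hpos.le, sub_eq_add_neg, Real.rpow_add hy,
      inner_smul_left]
    congr 1
    simp only [conj_trivial]
    ring
  refine ⟨(∫⁻ y, coneKernel V c b x₀ y ∂(coneInvMeasure V)).toNNReal, fun x hx => ?_⟩
  obtain ⟨A, hA, rfl⟩ := hV.transitive x₀ hx₀ x hx
  rw [ENNReal.coe_toNNReal hfin.ne, ← hP.lintegral_coneInvMeasure_map hA]
  simp_rw [hP.coneKernel_map hA hx₀]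
  exact le_rfl

/-- At a base point the exponential beats `Δ_V(z)^b`, which grows at most like `‖z‖^{nb}`. This
replaces the `L^{p'}` bound when `p = 1`. -/
lemma exists_coneKernel_le (hV : IsHomogeneousCone V) {c b : ℝ} (hc : 0 < c) (hb : 0 < b) :
    ∃ C : ℝ≥0, ∀ x ∈ V, ∀ y ∈ V, coneKernel V c b x y ≤ C := by
  have hP := hV.toIsOpenProperCone
  obtain ⟨x₀, hx₀⟩ := hV.nonempty
  have hpos := hP.coneDelta_pos hx₀
  obtain ⟨d, hd, h⟩ := hP.exists_le_inner (hP.coneStar_mem_openDualCone hx₀)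
  obtain ⟨K, hK, hΔ⟩ := hP.exists_coneDelta_le
  obtain ⟨M, hM⟩ : ∃ M : ℝ, ∀ r : ℝ, 0 ≤ r → Real.exp (-(c * (d * r))) * (r ^ n) ^ b ≤ M := by
    obtain ⟨N, hN⟩ := exists_nat_gt (n * b)
    have hcd : 0 < c * d := by positivity
    -- The bound combines `r^{nb} ≤ 1 + r^N` with the `N`-th term of the exponential series of
    -- `cdr`.
    refine ⟨1 + N.factorial / (c * d) ^ N, fun r hr => ?_⟩
    have h1 : (r ^ n) ^ b ≤ 1 + r ^ N := by
      rw [← Real.rpow_natCast, ← Real.rpow_mul hr]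
      rcases le_total r 1 with h | h
      · have := Real.rpow_le_one hr h (z := n * b) (by positivity)
        have := pow_nonneg hr N
        linarith
      · have := Real.rpow_le_rpow_of_exponent_le h hN.le
        rw [Real.rpow_natCast] at this
        linarith
    have h2 : (c * d * r) ^ N / N.factorial ≤ Real.exp (c * d * r) :=
      Real.pow_div_factorial_le_exp _ (by positivity) N
    have h3 : r ^ N ≤ N.factorial / (c * d) ^ N * Real.exp (c * (d * r)) := by
      rw [mul_pow, div_le_iff₀ (by positivity)] at h2
      rw [div_mul_eq_mul_div, le_div_iff₀ (by positivity), ← mul_assoc c]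
      linarith
    have h4 : Real.exp (-(c * (d * r))) ≤ 1 := Real.exp_le_one_iff.2 (by
      have : 0 ≤ c * (d * r) := by positivity
      linarith)
    calc Real.exp (-(c * (d * r))) * (r ^ n) ^ b
        ≤ Real.exp (-(c * (d * r))) * (1 + N.factorial / (c * d) ^ N * Real.exp (c * (d * r))) := by
          gcongr
          linarith
      _ = Real.exp (-(c * (d * r))) + N.factorial / (c * d) ^ N := by
          rw [Real.exp_neg]
          field_simp
      _ ≤ _ := by gcongr
  refine ⟨(M * (K / coneDelta V x₀) ^ b).toNNReal, fun x hx y hy => ?_⟩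
  obtain ⟨A, hA, rfl⟩ := hV.transitive x₀ hx₀ x hx
  obtain ⟨z, hz, rfl⟩ := hA.symm ▸ hy
  rw [hP.coneKernel_map hA hx₀]
  refine ENNReal.ofReal_le_ofReal ?_
  have hz' := hP.coneDelta_pos hz
  calc Real.exp (-(c * inner ℝ (coneStar V x₀) z)) * (coneDelta V z / coneDelta V x₀) ^ b
      ≤ Real.exp (-(c * (d * ‖z‖))) * ((K * ‖z‖ ^ n) / coneDelta V x₀) ^ b := by
        gcongr
        · exact h z (subset_closure hz)
        · exact hΔ z
    _ = Real.exp (-(c * (d * ‖z‖))) * (‖z‖ ^ n) ^ b * (K / coneDelta V x₀) ^ b := by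
        rw [mul_assoc, ← Real.mul_rpow (by positivity) (by positivity)]
        ring_nf
    _ ≤ _ := by
        gcongr
        exact hM _ (norm_nonneg z)

end IsHomogeneousCone

/-! ### Integrating the kernel in `x` by way of the dual cone -/

section DualInterval

/-- An interval of the dual cone around the point `x*`, attached equivariantly to `x`. -/
def starInterval (V : Set (EuclideanSpace ℝ (Fin n))) (x : EuclideanSpace ℝ (Fin n)) :
    Set (EuclideanSpace ℝ (Fin n)) :=
  coneInterval (openDualCone V) ((1 / 2 : ℝ) • coneStar V x) ((2 : ℝ) • coneStar V x)

lemma starInterval_subset (V : Set (EuclideanSpace ℝ (Fin n))) (x : EuclideanSpace ℝ (Fin n)) :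
    starInterval V x ⊆ coneInterval (openDualCone V) 0 ((2 : ℝ) • coneStar V x) :=
  fun _ ht => mem_coneInterval_zero.2 ⟨ht.1, ht.2.2⟩

namespace IsOpenProperCone

lemma adjointEquiv_image_starInterval (hV : IsOpenProperCone V)
    {A : EuclideanSpace ℝ (Fin n) ≃ₗ[ℝ] EuclideanSpace ℝ (Fin n)} (hA : A '' V = V)
    {x : EuclideanSpace ℝ (Fin n)} (hx : x ∈ V) :
    adjointEquiv A '' starInterval V (A x) = starInterval V x := by
  have hB := adjointEquiv_image_openDualCone hA
  have hiff : ∀ t, adjointEquiv A t ∈ starInterval V x ↔ t ∈ starInterval V (A x) := fun t => by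
    simp only [starInterval, coneInterval, Set.mem_ofPred_eq]
    rw [← hV.adjointEquiv_coneStar hA hx, ← map_smul, ← map_smul, ← map_sub, ← map_sub,
      mem_iff_of_image_eq hB, mem_iff_of_image_eq hB, mem_iff_of_image_eq hB]
  ext t
  refine ⟨?_, fun ht => ⟨(adjointEquiv A).symm t, ?_, by simp⟩⟩
  · rintro ⟨s, hs, rfl⟩
    exact (hiff s).2 hs
  · rw [← hiff]
    simpa using ht

lemma measurableSet_starInterval (hV : IsOpenProperCone V) :
    MeasurableSet {p : EuclideanSpace ℝ (Fin n) × EuclideanSpace ℝ (Fin n) |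
      p.2 ∈ starInterval V p.1} := by
  have hm := hV.isOpen_openDualCone.measurableSet
  have hs := measurable_coneStar V
  have h1 : Measurable fun p : EuclideanSpace ℝ (Fin n) × EuclideanSpace ℝ (Fin n) =>
    p.2 - (1 / 2 : ℝ) • coneStar V p.1 := by fun_prop
  have h2 : Measurable fun p : EuclideanSpace ℝ (Fin n) × EuclideanSpace ℝ (Fin n) =>
    (2 : ℝ) • coneStar V p.1 - p.2 := by fun_prop
  exact (measurable_snd hm).inter ((h1 hm).inter (h2 hm))

end IsOpenProperCone

namespace IsHomogeneousCone

/-- Under `A` both sides scale by `|det A|⁻¹`, so the constant is fixed by one base point. -/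
lemma exists_inv_coneDelta_le_volume (hV : IsHomogeneousCone V) :
    ∃ C : ℝ≥0, ∀ x ∈ V, ENNReal.ofReal (coneDelta V x)⁻¹ ≤ C * volume (starInterval V x) := by
  have hP := hV.toIsOpenProperCone
  obtain ⟨x₀, hx₀⟩ := hV.nonempty
  have hpos := hP.coneDelta_pos hx₀
  have hfin : volume (starInterval V x₀) ≠ ∞ :=
    ((measure_mono (starInterval_subset V x₀)).trans_lt
      (hP.dual.volume_coneInterval_lt_top _)).ne
  have hne : volume (starInterval V x₀) ≠ 0 := by
    have hs := hP.coneStar_mem_openDualCone hx₀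
    refine ((hP.dual.isOpen_coneInterval _ _).measure_pos _ ⟨coneStar V x₀, hs, ?_, ?_⟩).ne'
    · convert hP.dual.smul_mem _ hs (1 / 2) (by norm_num) using 1
      module
    · convert hs using 1
      module
  refine ⟨(ENNReal.ofReal (coneDelta V x₀)⁻¹ * (volume (starInterval V x₀))⁻¹).toNNReal,
    fun x hx => ?_⟩
  obtain ⟨A, hA, rfl⟩ := hV.transitive x₀ hx₀ x hx
  have hd := absDet_pos A
  rw [ENNReal.coe_toNNReal (ENNReal.mul_ne_top ENNReal.ofReal_ne_top (ENNReal.inv_ne_top.2 hne)),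
    coneDelta_map hA, mul_inv, ENNReal.ofReal_mul (by positivity), mul_comm (ENNReal.ofReal _),
    mul_assoc]
  gcongr
  have h := volume_image_linearEquiv (adjointEquiv A) (starInterval V (A x₀))
  rw [hP.adjointEquiv_image_starInterval hA hx₀, absDet_adjointEquiv] at h
  have h' : volume (starInterval V (A x₀)) =
      ENNReal.ofReal (absDet A)⁻¹ * volume (starInterval V x₀) := by
    rw [h, ← mul_assoc, ← ENNReal.ofReal_mul (by positivity), inv_mul_cancel₀ hd.ne']
    simp
  rw [h', mul_left_comm, ENNReal.inv_mul_cancel hne hfin, mul_one]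

/-- The product `Δ_{V*}(x*) Δ_V(x)` is invariant under automorphisms. -/
lemma exists_coneDelta_coneStar (hV : IsHomogeneousCone V) :
    ∃ κ > 0, ∀ x ∈ V, coneDelta (openDualCone V) (coneStar V x) = κ * (coneDelta V x)⁻¹ := by
  have hP := hV.toIsOpenProperCone
  obtain ⟨x₀, hx₀⟩ := hV.nonempty
  have hpos := hP.coneDelta_pos hx₀
  refine ⟨coneDelta (openDualCone V) (coneStar V x₀) * coneDelta V x₀,
    mul_pos (hP.dual.coneDelta_pos (hP.coneStar_mem_openDualCone hx₀)) hpos, fun x hx => ?_⟩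
  obtain ⟨A, hA, rfl⟩ := hV.transitive x₀ hx₀ x hx
  have hd := absDet_pos A
  rw [← hP.adjointEquiv_coneStar hA hx₀, coneDelta_map (adjointEquiv_image_openDualCone hA),
    coneDelta_map hA, absDet_adjointEquiv]
  field_simp

/-- `Δ_{V*}` is monotone for the cone order, hence lies between its values at `x*/2` and `2x*`. -/
lemma exists_coneDelta_starInterval (hV : IsHomogeneousCone V) :
    ∃ K > 0, ∀ x ∈ V, ∀ t ∈ starInterval V x,
      (coneDelta V x)⁻¹ ≤ K * coneDelta (openDualCone V) t ∧
      coneDelta (openDualCone V) t ≤ K * (coneDelta V x)⁻¹ := by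
  have hP := hV.toIsOpenProperCone
  obtain ⟨κ, hκ, h⟩ := hV.exists_coneDelta_coneStar
  refine ⟨max (2 ^ n / κ) (2 ^ n * κ), lt_max_of_lt_left (by positivity), fun x hx t ht => ?_⟩
  have h1 := hP.dual.coneDelta_le_of_sub_mem ht.2.1
  have h2 := hP.dual.coneDelta_le_of_sub_mem ht.2.2
  rw [coneDelta_smul hP.dual (by norm_num), h x hx] at h1 h2
  have hΔ := hP.coneDelta_pos hx
  have hΔt := coneDelta_nonneg (openDualCone V) t
  constructor
  · refine le_trans ?_ (mul_le_mul_of_nonneg_right (le_max_left _ _) hΔt)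
    calc (coneDelta V x)⁻¹ = 2 ^ n / κ * ((1 / 2) ^ n * (κ * (coneDelta V x)⁻¹)) := by
          rw [one_div, inv_pow]; field_simp
      _ ≤ _ := by gcongr
  · refine le_trans ?_ (mul_le_mul_of_nonneg_right (le_max_right _ _) (by positivity))
    rwa [mul_assoc]

/-- If the intervals of `x` and `x₁ = A x₀` share the point `t`, then `x₁*/2 < t < 2x*` in the order
of `V*`. Pairing with `x = A z` gives `x₀*·z ≤ 4 x*·x = 4 x₀*·x₀`, so `z` lies in a fixed bounded
set `Z`. -/
lemma exists_coneDelta_mul_volume_le (hV : IsHomogeneousCone V) :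
    ∃ C : ℝ≥0, ∀ t, ENNReal.ofReal (coneDelta (openDualCone V) t) *
      volume {x | x ∈ V ∧ t ∈ starInterval V x} ≤ C := by
  have hP := hV.toIsOpenProperCone
  obtain ⟨x₀, hx₀⟩ := hV.nonempty
  have hpos := hP.coneDelta_pos hx₀
  obtain ⟨K, hK, hΔ⟩ := hV.exists_coneDelta_starInterval
  set Z := {z | z ∈ V ∧ inner ℝ (coneStar V x₀) z ≤ 4 * inner ℝ (coneStar V x₀) x₀} with hZ
  have hZfin : volume Z ≠ ∞ := by
    obtain ⟨d, hd, h⟩ := hP.exists_le_inner (hP.coneStar_mem_openDualCone hx₀)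
    refine ((measure_mono fun z hz => ?_).trans_lt (measure_closedBall_lt_top (x := 0)
      (r := 4 * inner ℝ (coneStar V x₀) x₀ / d))).ne
    rw [mem_closedBall_zero_iff, le_div_iff₀ hd, mul_comm]
    exact (h z (subset_closure hz.1)).trans hz.2
  refine ⟨(ENNReal.ofReal (K * (coneDelta V x₀)⁻¹) * volume Z).toNNReal, fun t => ?_⟩
  rw [ENNReal.coe_toNNReal (ENNReal.mul_ne_top ENNReal.ofReal_ne_top hZfin)]
  rcases Set.eq_empty_or_nonempty {x | x ∈ V ∧ t ∈ starInterval V x} with h | ⟨x₁, hx₁, ht₁⟩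
  · rw [h]; simp
  obtain ⟨A, hA, rfl⟩ := hV.transitive x₀ hx₀ x₁ hx₁
  have hd := absDet_pos A
  have hsub : {x | x ∈ V ∧ t ∈ starInterval V x} ⊆ A '' Z := by
    rintro x ⟨hx, ht⟩
    obtain ⟨z, hz, rfl⟩ := hA.symm ▸ hx
    refine ⟨z, ⟨hz, ?_⟩, rfl⟩
    obtain ⟨D, hD, hDz⟩ := hV.transitive x₀ hx₀ _ hx
    have h1 := inner_nonneg_of_mem_closure_openDualCone (subset_closure ht₁.2.1) (subset_closure hx)
    have h2 := inner_nonneg_of_mem_closure_openDualCone (subset_closure ht.2.2) (subset_closure hx)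
    have h3 : inner ℝ (coneStar V (A z)) (A z) = inner ℝ (coneStar V x₀) x₀ := by
      rw [← hDz, hP.inner_coneStar_map hD hx₀]
    rw [inner_sub_left, inner_smul_left, hP.inner_coneStar_map hA hx₀] at h1
    rw [inner_sub_left, inner_smul_left, h3] at h2
    simp only [conj_trivial] at h1 h2
    linarith
  calc ENNReal.ofReal (coneDelta (openDualCone V) t) * volume {x | x ∈ V ∧ t ∈ starInterval V x}
      ≤ ENNReal.ofReal (K * (coneDelta V (A x₀))⁻¹) * volume (A '' Z) := by
        gcongr
        exact (hΔ _ hx₁ t ht₁).2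
    _ = ENNReal.ofReal (K * (coneDelta V x₀)⁻¹) * volume Z := by
        rw [volume_image_linearEquiv, coneDelta_map hA, ← mul_assoc,
          ← ENNReal.ofReal_mul (by positivity)]
        congr 2
        field_simp

/-- For `t` in the interval of `x`, the relation `t < 2x*` gives `e^{-c x*·y₀} ≤ e^{-(c/2) t·y₀}`,
while `Δ_V(x)⁻¹` is at most a multiple of both `Δ_{V*}(t)` and the volume of the interval. Averaging
over `t` and exchanging the integrals leaves an integral over `V*`. -/
lemma exists_lintegral_coneKernel_left_le (hV : IsHomogeneousCone V) {c b : ℝ} (hc : 0 < c)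
    (hb : coneSigma (openDualCone V) + 1 < b) :
    ∃ C : ℝ≥0, ∀ y ∈ V, ∫⁻ x, coneKernel V c b x y ∂(coneInvMeasure V) ≤ C := by
  have hP := hV.toIsOpenProperCone
  obtain ⟨y₀, hy₀⟩ := hV.nonempty
  -- As `σ ≥ -1`, the exponent is nonnegative, so `b`-th powers preserve inequalities.
  have hb0 : 0 ≤ b := by linarith [neg_one_le_coneSigma (openDualCone V)]
  have hpos := hP.coneDelta_pos hy₀
  have hfin : ∫⁻ x, coneKernel V c b x y₀ ∂(coneInvMeasure V) < ∞ := by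
    obtain ⟨d, hd, h⟩ := hP.exists_le_inner_of_mem hy₀
    obtain ⟨C₁, hC₁⟩ := hV.exists_inv_coneDelta_le_volume
    obtain ⟨K, hK, hΔ⟩ := hV.exists_coneDelta_starInterval
    obtain ⟨C₂, hC₂⟩ := hV.exists_coneDelta_mul_volume_le
    have key := hP.dual.lintegral_exp_mul_coneWeight_lt_top (β := b - 1) (c := c / 2 * d)
      (ξ := (c / 2) • y₀) (by linarith) (by positivity) fun t ht => by
        rw [inner_smul_left, mul_assoc]
        exact mul_le_mul_of_nonneg_left (h t (subset_closure ht)) (by positivity)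
    set S := {p : EuclideanSpace ℝ (Fin n) × EuclideanSpace ℝ (Fin n) |
      p.2 ∈ starInterval V p.1} with hS
    have hSm : MeasurableSet S := hP.measurableSet_starInterval
    set g : EuclideanSpace ℝ (Fin n) → ℝ≥0∞ := fun t =>
      ENNReal.ofReal (Real.exp (-(inner ℝ ((c / 2) • y₀) t))) * coneWeight (openDualCone V) b t
      with hg
    have hgm : Measurable g := by
      have := measurable_coneWeight hP.isOpen_openDualCone b
      fun_prop
    set L : ℝ≥0∞ := ENNReal.ofReal ((coneDelta V y₀ * K) ^ b) with hL
    have hpt : ∀ x ∈ V, coneWeight V (-1) x * coneKernel V c b x y₀ ≤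
        C₁ * L * ∫⁻ t in openDualCone V, S.indicator (fun p => g p.2) (x, t) := fun x hx => by
      have hx' := hP.coneDelta_pos hx
      have hE : ∀ t ∈ starInterval V x, coneKernel V c b x y₀ ≤ L * g t := fun t ht => by
        have hΔt := coneDelta_nonneg (openDualCone V) t
        dsimp only [g, L]
        rw [coneKernel, coneWeight, ← ENNReal.ofReal_mul (by positivity),
          ← ENNReal.ofReal_mul (by positivity)]
        refine ENNReal.ofReal_le_ofReal ?_
        rw [mul_left_comm, ← Real.mul_rpow (by positivity) hΔt]
        gcongr
        · have := inner_nonneg_of_mem_closure_openDualCone (subset_closure ht.2.2)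
            (subset_closure hy₀)
          rw [inner_sub_left, inner_smul_left] at this
          rw [inner_smul_left, real_inner_comm t y₀]
          simp only [conj_trivial] at this ⊢
          nlinarith
        · rw [div_eq_mul_inv, mul_assoc]
          gcongr
          exact (hΔ x hx t ht).1
      have hm : MeasurableSet (starInterval V x) := (hP.dual.isOpen_coneInterval _ _).measurableSet
      have hind : ∫⁻ t in openDualCone V, S.indicator (fun p => g p.2) (x, t) =
          ∫⁻ t in starInterval V x, g t := by
        have : (fun t => S.indicator (fun p => g p.2) (x, t)) = (starInterval V x).indicator g := by
          ext t; rfl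
        rw [this, setLIntegral_indicator hm,
          Set.inter_eq_self_of_subset_left (fun t ht => ht.1)]
      rw [hind, mul_assoc, ← lintegral_const_mul _ hgm]
      calc coneWeight V (-1) x * coneKernel V c b x y₀
          ≤ C₁ * volume (starInterval V x) * coneKernel V c b x y₀ := by
            gcongr
            rw [coneWeight, Real.rpow_neg_one]
            exact hC₁ x hx
        _ = C₁ * ∫⁻ t in starInterval V x, coneKernel V c b x y₀ := by
            rw [setLIntegral_const]; ring
        _ ≤ _ := by
            exact mul_le_mul' le_rfl (setLIntegral_mono' hm hE)
    have hFm : Measurable fun p => S.indicator (fun p => g p.2) p :=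
      (hgm.comp measurable_snd).indicator hSm
    rw [hP.lintegral_coneInvMeasure]
    refine (setLIntegral_mono' hP.isOpen.measurableSet hpt).trans_lt ?_
    have hCL : (C₁ : ℝ≥0∞) * L ≠ ∞ := ENNReal.mul_ne_top ENNReal.coe_ne_top ENNReal.ofReal_ne_top
    rw [lintegral_const_mul' _ _ hCL, lintegral_lintegral_swap hFm.aemeasurable]
    refine ENNReal.mul_lt_top hCL.lt_top (lt_of_le_of_lt ?_
      (ENNReal.mul_lt_top (ENNReal.coe_lt_top (r := C₂)) key))
    rw [← lintegral_const_mul' _ _ ENNReal.coe_ne_top]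
    refine setLIntegral_mono' hP.isOpen_openDualCone.measurableSet fun t ht => ?_
    have ht' := hP.dual.coneDelta_pos ht
    have hmt : MeasurableSet {x | t ∈ starInterval V x} := measurable_prodMk_right hSm
    have : (fun x => S.indicator (fun p => g p.2) (x, t)) =
        {x | t ∈ starInterval V x}.indicator fun _ => g t := by
      ext x; rfl
    rw [this, lintegral_indicator hmt, lintegral_const, Measure.restrict_apply_univ,
      Measure.restrict_apply hmt, Set.inter_comm]
    -- One power of `Δ_{V*}(t)` absorbs the volume of `{x | t ∈ starInterval V x}`; the remaining
    -- exponent `b - 1` exceeds `σ(V*)`.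
    have hw : coneWeight (openDualCone V) b t =
        coneWeight (openDualCone V) (b - 1) t * ENNReal.ofReal (coneDelta (openDualCone V) t) := by
      rw [coneWeight, coneWeight, ← ENNReal.ofReal_mul (by positivity), Real.rpow_sub_one ht'.ne',
        div_mul_cancel₀ _ ht'.ne']
    have := hC₂ t
    calc g t * volume (V ∩ {x | t ∈ starInterval V x}) =
        (ENNReal.ofReal (coneDelta (openDualCone V) t) *
          volume {x | x ∈ V ∧ t ∈ starInterval V x}) *
        (ENNReal.ofReal (Real.exp (-(inner ℝ ((c / 2) • y₀) t))) *
          coneWeight (openDualCone V) (b - 1) t) := by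
          rw [hg]
          dsimp only
          rw [hw]
          change _ * volume {x | x ∈ V ∧ t ∈ starInterval V x} = _
          ring
      _ ≤ _ := by gcongr
  refine ⟨(∫⁻ x, coneKernel V c b x y₀ ∂(coneInvMeasure V)).toNNReal, fun y hy => ?_⟩
  obtain ⟨A, hA, rfl⟩ := hV.transitive y₀ hy₀ y hy
  rw [ENNReal.coe_toNNReal hfin.ne, ← hP.lintegral_coneInvMeasure_map hA]
  refine lintegral_mono_ae ?_
  filter_upwards [hP.ae_mem_coneInvMeasure] with x hx
  rw [hP.coneKernel_map hA hx]

end IsHomogeneousCone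

end DualInterval

end Kernel

/-- Jensen's inequality for the measure `G dμ`. -/
lemma lintegral_mul_rpow_le {α : Type*} [MeasurableSpace α] {μ : Measure α} {m : ℝ} (hm : 1 ≤ m)
    {H G : α → ℝ≥0∞} (hH : AEMeasurable H μ) (hG : AEMeasurable G μ) :
    (∫⁻ y, H y * G y ∂μ) ^ m ≤ (∫⁻ y, H y ^ m * G y ∂μ) * (∫⁻ y, G y ∂μ) ^ (m - 1) := by
  rcases hm.eq_or_lt with rfl | hm
  · simp
  have hm0 : 0 < m := by linarith
  have hc := Real.HolderConjugate.conjExponent hm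
  -- Hölder applied after splitting `G = G^{1/m} G^{1/m'}`.
  have h := ENNReal.lintegral_mul_le_Lp_mul_Lq μ hc
    (f := fun y => H y * G y ^ (1 / m)) (g := fun y => G y ^ (1 / m.conjExponent))
    (hH.mul (hG.pow_const _)) (hG.pow_const _)
  have e1 : ∀ y, ((fun y => H y * G y ^ (1 / m)) * fun y => G y ^ (1 / m.conjExponent)) y =
      H y * G y := fun y => by
    rw [Pi.mul_apply, mul_assoc, ← ENNReal.rpow_add_of_nonneg _ _ (by positivity)
      hc.symm.one_div_nonneg]
    simp only [one_div]
    rw [hc.inv_add_inv_eq_one, ENNReal.rpow_one]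
  have e2 : ∀ y, (H y * G y ^ (1 / m)) ^ m = H y ^ m * G y := fun y => by
    rw [ENNReal.mul_rpow_of_nonneg _ _ hm0.le, ← ENNReal.rpow_mul, one_div_mul_cancel hm0.ne',
      ENNReal.rpow_one]
  have e3 : ∀ y, (G y ^ (1 / m.conjExponent)) ^ m.conjExponent = G y := fun y => by
    rw [← ENNReal.rpow_mul, one_div_mul_cancel hc.symm.ne_zero, ENNReal.rpow_one]
  simp_rw [e1, e2, e3] at h
  refine (ENNReal.rpow_le_rpow h hm0.le).trans_eq ?_
  rw [ENNReal.mul_rpow_of_nonneg _ _ hm0.le, ← ENNReal.rpow_mul, ← ENNReal.rpow_mul,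
    one_div_mul_cancel hm0.ne', ENNReal.rpow_one]
  congr 2
  rw [Real.conjExponent]
  have : m - 1 ≠ 0 := by linarith
  field_simp

/-! ### Norm estimates for the invariant integral operator -/

section Laplace

variable {n : ℕ} {V : Set (EuclideanSpace ℝ (Fin n))}

namespace IsOpenProperCone

lemma coneInvMeasure_absolutelyContinuous (V : Set (EuclideanSpace ℝ (Fin n))) :
    coneInvMeasure V ≪ volume.restrict V :=
  withDensity_absolutelyContinuous _ _

lemma coneWeight_mul (hV : IsOpenProperCone V) {x : EuclideanSpace ℝ (Fin n)} (hx : x ∈ V)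
    (s t : ℝ) : coneWeight V s x * coneWeight V t x = coneWeight V (s + t) x := by
  have := hV.coneDelta_pos hx
  rw [coneWeight, coneWeight, coneWeight, ← ENNReal.ofReal_mul (by positivity), Real.rpow_add this]

lemma coneWeight_rpow (hV : IsOpenProperCone V) {x : EuclideanSpace ℝ (Fin n)} (hx : x ∈ V)
    (s : ℝ) {r : ℝ} (hr : 0 ≤ r) : coneWeight V s x ^ r = coneWeight V (s * r) x := by
  have := hV.coneDelta_pos hx
  rw [coneWeight, coneWeight, ENNReal.ofReal_rpow_of_nonneg (by positivity) hr,
    ← Real.rpow_mul this.le]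

lemma coneWeight_zero (V : Set (EuclideanSpace ℝ (Fin n))) (x : EuclideanSpace ℝ (Fin n)) :
    coneWeight V 0 x = 1 := by simp [coneWeight]

lemma coneWeight_ne_top (V : Set (EuclideanSpace ℝ (Fin n))) (s : ℝ)
    (x : EuclideanSpace ℝ (Fin n)) : coneWeight V s x ≠ ∞ := ENNReal.ofReal_ne_top

lemma measurable_coneKernel_left (hV : IsOpenProperCone V) (c b : ℝ)
    (y : EuclideanSpace ℝ (Fin n)) : Measurable fun x => coneKernel V c b x y := by
  have h1 := measurable_coneStar V
  have h2 := measurable_coneDelta hV.isOpen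
  unfold coneKernel
  fun_prop

lemma measurable_coneKernel_right (hV : IsOpenProperCone V) (c b : ℝ)
    (x : EuclideanSpace ℝ (Fin n)) : Measurable fun y => coneKernel V c b x y := by
  have h1 := measurable_coneStar V
  have h2 := measurable_coneDelta hV.isOpen
  unfold coneKernel
  fun_prop

/-- The weighted Laplace operator as an integral operator with an invariant kernel. -/
lemma coneWeight_mul_coneLaplace (hV : IsOpenProperCone V) {x : EuclideanSpace ℝ (Fin n)}
    (hx : x ∈ V) (s : ℝ) (f : EuclideanSpace ℝ (Fin n) → ℝ≥0∞) :
    coneWeight V (s - 1) x * coneLaplace V (fun y => f y * coneWeight V (-s) y) x =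
      ∫⁻ y, coneKernel V 1 (1 - s) x y * f y ∂(coneInvMeasure V) := by
  rw [hV.lintegral_coneInvMeasure, coneLaplace, ← lintegral_const_mul' _ _ (coneWeight_ne_top V _ x)]
  refine setLIntegral_congr_fun hV.isOpen.measurableSet fun y hy => ?_
  have hx' := hV.coneDelta_pos hx
  have hy' := hV.coneDelta_pos hy
  have : coneKernel V 1 (1 - s) x y = ENNReal.ofReal (Real.exp (-(inner ℝ (coneStar V x) y))) *
      (coneWeight V (s - 1) x * coneWeight V (1 - s) y) := by
    rw [coneKernel, coneWeight, coneWeight, ← ENNReal.ofReal_mul (by positivity),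
      ← ENNReal.ofReal_mul (by positivity), one_mul, Real.div_rpow hy'.le hx'.le,
      ← neg_sub 1 s, Real.rpow_neg hx'.le, div_eq_inv_mul]
  rw [this]
  have h2 : coneWeight V (-s) y = coneWeight V (-1) y * coneWeight V (1 - s) y := by
    rw [hV.coneWeight_mul hy]
    congr 1
    ring
  rw [h2]
  ring

end IsOpenProperCone

namespace IsHomogeneousCone

/-- Hölder: the `p'`-th power of the kernel is again such a kernel, with exponent `a p' > σ(V) + 1`.
For `p = 1` the condition is `a > 0` and the kernel is bounded. -/
lemma exists_lintegral_coneKernel_mul_le (hV : IsHomogeneousCone V) {p a c : ℝ} (hp : 1 ≤ p)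
    (hc : 0 < c) (ha : (coneSigma V + 1) * (1 - 1 / p) < a) :
    ∃ C : ℝ≥0, ∀ x ∈ V, ∀ g : EuclideanSpace ℝ (Fin n) → ℝ≥0∞,
      AEMeasurable g (coneInvMeasure V) →
      ∫⁻ y, coneKernel V c a x y * g y ∂(coneInvMeasure V) ≤
        C * (∫⁻ y, g y ^ p ∂(coneInvMeasure V)) ^ (1 / p) := by
  have hP := hV.toIsOpenProperCone
  rcases hp.eq_or_lt with rfl | hp
  · obtain ⟨C, hC⟩ := hV.exists_coneKernel_le hc (by simpa using ha)
    refine ⟨C, fun x hx g hg => ?_⟩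
    simp only [ENNReal.rpow_one, div_one]
    rw [← lintegral_const_mul' _ _ ENNReal.coe_ne_top]
    refine lintegral_mono_ae ?_
    filter_upwards [hP.ae_mem_coneInvMeasure] with y hy
    gcongr
    exact hC x hx y hy
  · have hq := Real.HolderConjugate.conjExponent hp
    have hq0 := hq.symm.pos
    have hpq : 1 - 1 / p = 1 / p.conjExponent := by
      have := hq.inv_add_inv_eq_one
      simp only [one_div]
      linarith
    obtain ⟨C, hC⟩ := hV.exists_lintegral_coneKernel_le (c := c * p.conjExponent)
      (b := a * p.conjExponent) (by positivity) (by
        rw [hpq, mul_one_div, div_lt_iff₀ hq0] at ha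
        exact ha)
    refine ⟨C ^ (1 / p.conjExponent), fun x hx g hg => ?_⟩
    have h := ENNReal.lintegral_mul_le_Lp_mul_Lq (coneInvMeasure V) hq.symm
      (hP.measurable_coneKernel_right c a x).aemeasurable hg
    have hk : ∫⁻ y, coneKernel V c a x y ^ p.conjExponent ∂(coneInvMeasure V) ≤ C := by
      refine le_trans (lintegral_mono_ae ?_) (hC x hx)
      filter_upwards [hP.ae_mem_coneInvMeasure] with y hy
      rw [hP.coneKernel_rpow hx hy _ _ hq0.le]
    refine h.trans ?_
    rw [ENNReal.coe_rpow_of_nonneg _ hq.symm.one_div_nonneg]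
    exact mul_le_mul' (ENNReal.rpow_le_rpow hk hq.symm.one_div_nonneg) le_rfl

/-- The exponential is halved and the exponent `t` is shared between two factors, one integrated in
`y` and the other in `x`. -/
lemma exists_lintegral_lintegral_coneKernel_mul_rpow_le (hV : IsHomogeneousCone V) {p q t : ℝ}
    (hp : 1 ≤ p) (hpq : p ≤ q)
    (ht : (coneSigma V + 1) * (1 - 1 / p) + (coneSigma (openDualCone V) + 1) / q < t) :
    ∃ C : ℝ≥0, ∀ g : EuclideanSpace ℝ (Fin n) → ℝ≥0∞,
      AEMeasurable g (coneInvMeasure V) →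
      (∫⁻ x, (∫⁻ y, coneKernel V 1 t x y * g y ∂(coneInvMeasure V)) ^ q ∂(coneInvMeasure V)) ^
          (1 / q) ≤
        C * (∫⁻ y, g y ^ p ∂(coneInvMeasure V)) ^ (1 / p) := by
  have hP := hV.toIsOpenProperCone
  have hp0 : 0 < p := by linarith
  have hq0 : 0 < q := by linarith
  -- The gap in `ht` leaves room for `(σ(V)+1)/p' < a` together with `(t - a) q > σ(V*) + 1`.
  obtain ⟨a, ha1, ha2⟩ := exists_between (lt_sub_iff_add_lt.2 ht)
  obtain ⟨C₁, hC₁⟩ := hV.exists_lintegral_coneKernel_mul_le hp (c := 1 / 2) (by norm_num) ha1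
  obtain ⟨C₂, hC₂⟩ := hV.exists_lintegral_coneKernel_left_le (c := 1 / 2 * q) (b := (t - a) * q)
    (by positivity) (by
      rw [← div_lt_iff₀ hq0]
      linarith)
  have hm : 1 ≤ q / p := (one_le_div hp0).2 hpq
  refine ⟨C₁ * C₂ ^ (1 / q), fun g hg => ?_⟩
  have hG : AEMeasurable (fun y => g y ^ p) (coneInvMeasure V) := hg.pow_const p
  have hF : AEMeasurable (fun z : EuclideanSpace ℝ (Fin n) × EuclideanSpace ℝ (Fin n) =>
      coneKernel V (1 / 2 * q) ((t - a) * q) z.1 z.2 * g z.2 ^ p)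
      ((coneInvMeasure V).prod (coneInvMeasure V)) :=
    (hP.measurable_coneKernel _ _).aemeasurable.mul
      (hG.comp_quasiMeasurePreserving Measure.quasiMeasurePreserving_snd)
  set I := ∫⁻ y, g y ^ p ∂(coneInvMeasure V) with hI
  have hpt : ∀ x ∈ V, (∫⁻ y, coneKernel V 1 t x y * g y ∂(coneInvMeasure V)) ^ q ≤
      C₁ ^ q * I ^ (q / p - 1) *
        ∫⁻ y, coneKernel V (1 / 2 * q) ((t - a) * q) x y * g y ^ p ∂(coneInvMeasure V) := by
    intro x hx
    have h1 : ∫⁻ y, coneKernel V 1 t x y * g y ∂(coneInvMeasure V) ≤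
        C₁ * (∫⁻ y, coneKernel V (1 / 2) (t - a) x y ^ p * g y ^ p
          ∂(coneInvMeasure V)) ^ (1 / p) := by
      refine le_trans (le_of_eq ?_) ((hC₁ x hx (fun y => coneKernel V (1 / 2) (t - a) x y * g y)
        ((hP.measurable_coneKernel_right _ _ x).aemeasurable.mul hg)).trans_eq ?_)
      · refine lintegral_congr_ae ?_
        filter_upwards [hP.ae_mem_coneInvMeasure] with y hy
        rw [← mul_assoc, hP.coneKernel_mul hx hy]
        norm_num
      · simp_rw [ENNReal.mul_rpow_of_nonneg _ _ hp0.le]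
    have h2 := lintegral_mul_rpow_le hm
      ((hP.measurable_coneKernel_right (1 / 2) (t - a) x).pow_const p).aemeasurable hG
    have h3 : ∫⁻ y, (coneKernel V (1 / 2) (t - a) x y ^ p) ^ (q / p) * g y ^ p
        ∂(coneInvMeasure V) = ∫⁻ y, coneKernel V (1 / 2 * q) ((t - a) * q) x y * g y ^ p
          ∂(coneInvMeasure V) := by
      refine lintegral_congr_ae ?_
      filter_upwards [hP.ae_mem_coneInvMeasure] with y hy
      rw [← ENNReal.rpow_mul, mul_div_cancel₀ _ hp0.ne', hP.coneKernel_rpow hx hy _ _ hq0.le]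
    rw [h3] at h2
    refine (ENNReal.rpow_le_rpow h1 hq0.le).trans ?_
    rw [ENNReal.mul_rpow_of_nonneg _ _ hq0.le, ← ENNReal.rpow_mul, one_div_mul_eq_div, mul_assoc]
    gcongr
    rwa [mul_comm (I ^ _)]
  have hmain : ∫⁻ x, (∫⁻ y, coneKernel V 1 t x y * g y ∂(coneInvMeasure V)) ^ q
      ∂(coneInvMeasure V) ≤ C₁ ^ q * C₂ * I ^ (q / p) := by
    calc _ ≤ ∫⁻ x, C₁ ^ q * I ^ (q / p - 1) *
          ∫⁻ y, coneKernel V (1 / 2 * q) ((t - a) * q) x y * g y ^ p ∂(coneInvMeasure V)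
          ∂(coneInvMeasure V) := by
          refine lintegral_mono_ae ?_
          filter_upwards [hP.ae_mem_coneInvMeasure] with x hx using hpt x hx
      _ = C₁ ^ q * I ^ (q / p - 1) *
          ∫⁻ y, ∫⁻ x, coneKernel V (1 / 2 * q) ((t - a) * q) x y * g y ^ p ∂(coneInvMeasure V)
          ∂(coneInvMeasure V) := by
          rw [lintegral_const_mul'' _ hF.lintegral_prod_right', lintegral_lintegral_swap hF]
      _ ≤ C₁ ^ q * I ^ (q / p - 1) * (C₂ * I) := by
          gcongr
          rw [hI, ← lintegral_const_mul' _ _ ENNReal.coe_ne_top]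
          refine lintegral_mono_ae ?_
          filter_upwards [hP.ae_mem_coneInvMeasure] with y hy
          rw [lintegral_mul_const _ (hP.measurable_coneKernel_left _ _ y)]
          gcongr
          exact hC₂ y hy
      _ = C₁ ^ q * C₂ * I ^ (q / p) := by
          have : I ^ (q / p) = I ^ (q / p - 1) * I := by
            conv_rhs => rw [← ENNReal.rpow_one I, ← ENNReal.rpow_mul, one_mul]
            rw [← ENNReal.rpow_add_of_nonneg _ _ (by linarith) zero_le_one, sub_add_cancel]
          rw [this]
          ring
  refine (ENNReal.rpow_le_rpow hmain (by positivity)).trans_eq ?_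
  rw [ENNReal.mul_rpow_of_nonneg _ _ (by positivity), ENNReal.mul_rpow_of_nonneg _ _ (by positivity),
    ← ENNReal.rpow_mul, ← ENNReal.rpow_mul, mul_one_div_cancel hq0.ne', ENNReal.rpow_one,
    ENNReal.coe_mul, ENNReal.coe_rpow_of_nonneg _ (by positivity)]
  congr 2
  field_simp

end IsHomogeneousCone

end Laplace

/-! ### The three inequalities -/

theorem theorem3p15 {n : ℕ} (V : Set (EuclideanSpace ℝ (Fin n))) (hV : IsHomogeneousCone V) :
    (∀ p q γ : ℝ, 1 ≤ p → p ≤ q →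
      γ < -coneSigma V * (q * (1 - 1 / p)) - coneSigma (openDualCone V) + q / p - 2 →
      ∃ c : ℝ≥0, ∀ f : EuclideanSpace ℝ (Fin n) → ℝ≥0∞, AEMeasurable f (volume.restrict V) →
        (∫⁻ x in V, coneWeight V (γ - q) x * coneLaplace V f x ^ q) ^ (1 / q) ≤
          c * (∫⁻ x in V, f x ^ p * coneWeight V ((γ + 1) * p / q - 1) x) ^ (1 / p)) ∧
    (∀ p α : ℝ, 1 ≤ p → α < 1 / p - coneSigma V * (1 - 1 / p) →
      ∃ c : ℝ≥0, ∀ f : EuclideanSpace ℝ (Fin n) → ℝ≥0∞, AEMeasurable f (volume.restrict V) →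
        essSup (fun x => coneWeight V (-1 + α) x *
            coneLaplace V (fun y => f y * coneWeight V (-α) y) x) (volume.restrict V) ≤
          c * (∫⁻ x in V, f x ^ p * coneWeight V (-1) x) ^ (1 / p)) ∧
    (∀ α : ℝ, α < -coneSigma V →
      ∃ c : ℝ≥0, ∀ f : EuclideanSpace ℝ (Fin n) → ℝ≥0∞, AEMeasurable f (volume.restrict V) →
        essSup (fun x => coneWeight V (-1 + α) x *
            coneLaplace V (fun y => f y * coneWeight V (-α) y) x) (volume.restrict V) ≤
          c * essSup f (volume.restrict V)) := by
  have hP := hV.toIsOpenProperCone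
  have hac := IsOpenProperCone.coneInvMeasure_absolutelyContinuous V
  refine ⟨fun p q γ hp hpq hγ => ?_, fun p α hp hα => ?_, fun α hα => ?_⟩
  · have hp0 : 0 < p := by linarith
    have hq0 : 0 < q := by linarith
    -- With this `s`, the substitution `g = f Δ_V^s` absorbs the weights on both sides into the
    -- invariant measure.
    set s := (γ + 1) / q with hs
    have hsq : s * q = γ + 1 := div_mul_cancel₀ _ hq0.ne'
    obtain ⟨C, hC⟩ := hV.exists_lintegral_lintegral_coneKernel_mul_rpow_le (t := 1 - s) hp hpq (by
      refine lt_of_mul_lt_mul_right ?_ hq0.le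
      rw [add_mul, div_mul_cancel₀ _ hq0.ne', sub_mul, hsq]
      have : q / p = q * (1 / p) := by ring
      rw [this] at hγ
      nlinarith)
    refine ⟨C, fun f hf => ?_⟩
    have hg : AEMeasurable (fun y => f y * coneWeight V s y) (coneInvMeasure V) :=
      (hf.mono_ac hac).mul (measurable_coneWeight hP.isOpen s).aemeasurable
    have hl : ∫⁻ x in V, coneWeight V (γ - q) x * coneLaplace V f x ^ q =
        ∫⁻ x, (∫⁻ y, coneKernel V 1 (1 - s) x y * (f y * coneWeight V s y) ∂(coneInvMeasure V)) ^ q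
          ∂(coneInvMeasure V) := by
      rw [hP.lintegral_coneInvMeasure]
      refine setLIntegral_congr_fun hP.isOpen.measurableSet fun x hx => ?_
      have hL : coneLaplace V (fun y => f y * coneWeight V s y * coneWeight V (-s) y) x =
          coneLaplace V f x := by
        refine setLIntegral_congr_fun hP.isOpen.measurableSet fun y hy => ?_
        dsimp only
        rw [mul_assoc (f y), hP.coneWeight_mul hy, add_neg_cancel,
          IsOpenProperCone.coneWeight_zero, mul_one]
      have he : -1 + (s - 1) * q = γ - q := by linarith
      rw [← hP.coneWeight_mul_coneLaplace hx, ENNReal.mul_rpow_of_nonneg _ _ hq0.le, ← mul_assoc,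
        hP.coneWeight_rpow hx _ hq0.le, hP.coneWeight_mul hx, hL, he]
    have hr : ∫⁻ x in V, f x ^ p * coneWeight V ((γ + 1) * p / q - 1) x =
        ∫⁻ y, (f y * coneWeight V s y) ^ p ∂(coneInvMeasure V) := by
      rw [hP.lintegral_coneInvMeasure]
      refine setLIntegral_congr_fun hP.isOpen.measurableSet fun x hx => ?_
      have he : -1 + s * p = (γ + 1) * p / q - 1 := by rw [hs]; ring
      rw [ENNReal.mul_rpow_of_nonneg _ _ hp0.le, mul_left_comm, hP.coneWeight_rpow hx _ hp0.le,
        hP.coneWeight_mul hx, he]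
    rw [hl, hr]
    exact hC _ hg
  -- The hypothesis on `α` is equivalent to `(σ(V)+1)/p' < 1 - α`.
  · obtain ⟨C, hC⟩ := hV.exists_lintegral_coneKernel_mul_le (a := 1 - α) hp one_pos (by linarith)
    refine ⟨C, fun f hf => essSup_le_of_ae_le _ ?_⟩
    filter_upwards [ae_restrict_mem hP.isOpen.measurableSet] with x hx
    rw [neg_add_eq_sub, hP.coneWeight_mul_coneLaplace hx]
    refine (hC x hx f (hf.mono_ac hac)).trans_eq ?_
    rw [hP.lintegral_coneInvMeasure]
    simp_rw [mul_comm]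
  · obtain ⟨C, hC⟩ := hV.exists_lintegral_coneKernel_le (b := 1 - α) one_pos (by linarith)
    refine ⟨C, fun f hf => essSup_le_of_ae_le _ ?_⟩
    filter_upwards [ae_restrict_mem hP.isOpen.measurableSet] with x hx
    rw [neg_add_eq_sub, hP.coneWeight_mul_coneLaplace hx]
    calc ∫⁻ y, coneKernel V 1 (1 - α) x y * f y ∂(coneInvMeasure V)
        ≤ ∫⁻ y, coneKernel V 1 (1 - α) x y * essSup f (volume.restrict V)
            ∂(coneInvMeasure V) := by
          refine lintegral_mono_ae ?_
          filter_upwards [hac.ae_le (ENNReal.ae_le_essSup f)] with y hy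
          gcongr
      _ ≤ C * essSup f (volume.restrict V) := by
          rw [lintegral_mul_const _ (hP.measurable_coneKernel_right _ _ x)]
          gcongr
          exact hC x hx
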